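/- Let $\mathbb K=\mathbb R$ or $\mathbb C$, let $U\subseteq\mathbb K^2$ be open, and let $$P^{ij}=g^{ij}(\mathbf u)\,d_x+\sum_{k} b^{ij}_k(\mathbf u)\,u^k_x,\qquad i,j,k\in\{1,2\},\quad d_x=\frac{d}{dx},$$ be a two-component operator of Dubrovin--Novikov type with coefficients that are $C^\infty$ (if $\mathbb K=\mathbb R$) or holomorphic (if $\mathbb K=\mathbb C$) on $U$. Assume that $P$ is Hamiltonian, i.e. that $\{F,G\}=\int \frac{\delta F}{\delta u^i}P^{ij}\frac{\delta G}{\delta u^j}\,dx$ is skew-symmetric and satisfies the Jacobi identity on local functionals $F=\int f(x,\mathbf u,\mathbf u_x,\dots,\mathbf u^{(N)})\,dx$ (densities being taken modulo total $x$-derivatives), and that $P$ is degenerate, i.e. $\det (g^{ij})=0$ on $U$. A change $\tilde{\mathbf u}=\tilde{\mathbf u}(\mathbf u)$ of the dependent variables (a local diffeomorphism, biholomorphic if $\mathbb K=\mathbb C$) with Jacobian matrix $J$ turns $P$ into $JPJ^{t}$. Call $p\in U$ a regular point of $P$ if the rank of $(g^{ij})$ is constant near $p$ and, in any local variables around $p$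 in which $g$ is constant, the coefficients $b^{ij}_k$ either all vanish identically near $p$ or do not all vanish at $p$. Then the regular points are dense in $U$, and near every regular point $p$ such that $P$ is not identically zero in a neighbourhood of $p$, the operator $P$ (if $\mathbb K=\mathbb C$), respectively $P$ or $-P$ (if $\mathbb K=\mathbb R$), can be brought, by a change of the dependent variables, to one of the following two canonical forms: $$\begin{pmatrix} d_x&0\\0&0\end{pmatrix},\qquad \begin{pmatrix} d_x&-\dfrac{u^2_x}{u^1}\\[2mm] \dfrac{u^2_x}{u^1}&0\end{pmatrix},$$ where in the second form the new variables take values in $\{u^1\ne0\}$. -/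

import Mathlib

open scoped ContDiff Topology

noncomputable section

/-- A (first order, homogeneous) Dubrovin-Novikov operator
`P^{ij} = g^{ij}(u) d/dx + b^{ij}_k(u) u^k_x` in `n` dependent variables:
`g u i j = g^{ij}(u)` and `b u i j k = b^{ij}_k(u)`. -/
structure DNOperator (𝕜 : Type*) (n : ℕ) where
  g : (Fin n → 𝕜) → Matrix (Fin n) (Fin n) 𝕜
  b : (Fin n → 𝕜) → Fin n → Fin n → Fin n → 𝕜

/-- A function of `x` and of the jet `w = (u, u_x, u_xx, ...)`, where `w k i` is the
`k`-th `x`-derivative of `u^i`. -/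
abbrev JetFunction (𝕜 : Type*) (n : ℕ) := 𝕜 → (ℕ → Fin n → 𝕜) → 𝕜

namespace JetFunction

variable {𝕜 : Type*} [RCLike 𝕜] {n : ℕ}

/-- `f` is a differential function over `U`: it depends on `x` and on finitely many
derivatives of `u` only, smoothly (holomorphically, over `ℂ`) as long as `u ∈ U`. -/
def IsDensity (U : Set (Fin n → 𝕜)) (f : JetFunction 𝕜 n) : Prop :=
  ∃ (N : ℕ) (F : 𝕜 × (Fin (N + 1) → Fin n → 𝕜) → 𝕜),
    ContDiffOn 𝕜 ∞ F {z | z.2 0 ∈ U} ∧ ∀ x w, f x w = F (x, fun k => w k)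

/-- The partial derivative `∂f/∂u^i_k` with respect to the `k`-th derivative of `u^i`. -/
def partialDeriv (i : Fin n) (k : ℕ) (f : JetFunction 𝕜 n) : JetFunction 𝕜 n := fun x w =>
  deriv (fun t => f x (Function.update w k (Function.update (w k) i t))) (w k i)

/-- The total derivative `d/dx f = ∂f/∂x + ∑ u^i_{k+1} ∂f/∂u^i_k`, written as a derivative
along the direction `(1, (u_x, u_xx, ...))`. -/
def totalDeriv (f : JetFunction 𝕜 n) : JetFunction 𝕜 n := fun x w =>
  deriv (fun t : 𝕜 => f (x + t) (fun k => w k + t • w (k + 1))) 0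

/-- The variational derivative `δF/δu^i = ∑_k (-d/dx)^k ∂f/∂u^i_k` of `F = ∫ f dx`.
The sum is finite, since `f` has finite order. -/
def varDeriv (f : JetFunction 𝕜 n) (i : Fin n) : JetFunction 𝕜 n := fun x w =>
  ∑ᶠ k : ℕ, (-1) ^ k * (totalDeriv^[k] (partialDeriv i k f)) x w

/-- `∫ f dx` is the zero functional: `f` is the total derivative of a density over `U`. -/
def IntegralEqZero (U : Set (Fin n → 𝕜)) (f : JetFunction 𝕜 n) : Prop :=
  ∃ h : JetFunction 𝕜 n, IsDensity U h ∧ ∀ x w, w 0 ∈ U → f x w = totalDeriv h x w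

end JetFunction

namespace DNOperator

open JetFunction

variable {𝕜 : Type*} [RCLike 𝕜] {n : ℕ}

/-- The coefficients are smooth on `U` (over `ℂ`: holomorphic). -/
def SmoothOn (P : DNOperator 𝕜 n) (U : Set (Fin n → 𝕜)) : Prop :=
  (∀ i j, ContDiffOn 𝕜 ∞ (fun u => P.g u i j) U) ∧
    ∀ i j k, ContDiffOn 𝕜 ∞ (fun u => P.b u i j k) U

/-- The action of the operator: `(P η)^i = g^{ij} dη_j/dx + b^{ij}_k u^k_x η_j`. -/
def apply (P : DNOperator 𝕜 n) (η : Fin n → JetFunction 𝕜 n) (i : Fin n) : JetFunction 𝕜 n :=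
  fun x w => ∑ j, P.g (w 0) i j * totalDeriv (η j) x w
    + ∑ j, ∑ k, P.b (w 0) i j k * w 1 k * η j x w

/-- The density of `{F, G} = ∫ δF/δu^i P^{ij} δG/δu^j dx`, for `F = ∫ f dx`, `G = ∫ h dx`. -/
def bracket (P : DNOperator 𝕜 n) (f h : JetFunction 𝕜 n) : JetFunction 𝕜 n :=
  fun x w => ∑ i, varDeriv f i x w * P.apply (varDeriv h) i x w

/-- `P` is Hamiltonian on `U`: the bracket of local functionals is skew-symmetric and
satisfies the Jacobi identity. -/
def IsHamiltonian (P : DNOperator 𝕜 n) (U : Set (Fin n → 𝕜)) : Prop :=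
  (∀ f h, IsDensity U f → IsDensity U h →
    IntegralEqZero U (fun x w => P.bracket f h x w + P.bracket h f x w)) ∧
  ∀ f h q, IsDensity U f → IsDensity U h → IsDensity U q →
    IntegralEqZero U (fun x w => P.bracket (P.bracket f h) q x w
      + P.bracket (P.bracket h q) f x w + P.bracket (P.bracket q f) h x w)

/-- The contravariant metric is degenerate on `U`. -/
def IsDegenerate (P : DNOperator 𝕜 n) (U : Set (Fin n → 𝕜)) : Prop :=
  ∀ u ∈ U, (P.g u).det = 0

/-- `P` vanishes identically near `p`. -/
def IsTrivialNear (P : DNOperator 𝕜 n) (p : Fin n → 𝕜) : Prop :=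
  ∀ᶠ u in 𝓝 p, P.g u = 0 ∧ P.b u = 0

/-- `φ` is a local change of the dependent variables, defined on an open neighbourhood of
`p` inside `U`: a diffeomorphism (over `ℂ`: a biholomorphism) between open sets. -/
def IsChangeOfVariables (U : Set (Fin n → 𝕜)) (p : Fin n → 𝕜)
    (φ : OpenPartialHomeomorph (Fin n → 𝕜) (Fin n → 𝕜)) : Prop :=
  p ∈ φ.source ∧ φ.source ⊆ U ∧
    ContDiffOn 𝕜 ∞ φ φ.source ∧ ContDiffOn 𝕜 ∞ φ.symm φ.target

/-- The partial derivative `∂φ^l/∂u^j` at `u`. -/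
def jac (φ : (Fin n → 𝕜) → (Fin n → 𝕜)) (l j : Fin n) (u : Fin n → 𝕜) : 𝕜 :=
  fderiv 𝕜 φ u (Pi.single j 1) l

/-- The second partial derivative `∂²φ^r/∂u^j∂u^k` at `u`. -/
def hess (φ : (Fin n → 𝕜) → (Fin n → 𝕜)) (r j k : Fin n) (u : Fin n → 𝕜) : 𝕜 :=
  fderiv 𝕜 (jac φ r j) u (Pi.single k 1)

/-- The operator `P` in the new variables `φ(u)`: with `J` the Jacobian matrix of `φ`, this is
`J P Jᵗ = J g Jᵗ d/dx + J g (Jᵗ)_x + J b Jᵗ`. -/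
def transform (P : DNOperator 𝕜 n)
    (φ : OpenPartialHomeomorph (Fin n → 𝕜) (Fin n → 𝕜)) : DNOperator 𝕜 n where
  g v := Matrix.of fun l r =>
    ∑ i, ∑ j, jac φ l i (φ.symm v) * jac φ r j (φ.symm v) * P.g (φ.symm v) i j
  b v := fun l r s =>
    (∑ i, ∑ j, ∑ k, jac φ l i (φ.symm v) * jac φ r j (φ.symm v) * jac φ.symm k s v
        * P.b (φ.symm v) i j k)
      + ∑ i, ∑ j, ∑ k, jac φ l i (φ.symm v) * hess φ r j k (φ.symm v) * jac φ.symm k s v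
        * P.g (φ.symm v) i j

/-- Near `p`, a change of the dependent variables turns `P` into `Q`, the new variables
taking values in the domain `Ω` of `Q`. -/
def CanBeBroughtTo (P : DNOperator 𝕜 n) (U : Set (Fin n → 𝕜)) (p : Fin n → 𝕜)
    (Q : DNOperator 𝕜 n) (Ω : Set (Fin n → 𝕜)) : Prop :=
  ∃ φ : OpenPartialHomeomorph (Fin n → 𝕜) (Fin n → 𝕜), IsChangeOfVariables U p φ ∧
    φ.target ⊆ Ω ∧
    ∀ v ∈ φ.target, (P.transform φ).g v = Q.g v ∧ (P.transform φ).b v = Q.b v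

/-- `p` is a regular (generic) point of `P`: the rank of `g` is constant near `p`, and in local
variables around `p` in which `g` is constant, the coefficients `b^{ij}_k` either all vanish
identically near `p` or do not all vanish at `p`. -/
def IsRegularAt (P : DNOperator 𝕜 n) (U : Set (Fin n → 𝕜)) (p : Fin n → 𝕜) : Prop :=
  (∀ᶠ u in 𝓝 p, (P.g u).rank = (P.g p).rank) ∧
  ∀ φ : OpenPartialHomeomorph (Fin n → 𝕜) (Fin n → 𝕜), IsChangeOfVariables U p φ →
    (∀ v ∈ φ.target, (P.transform φ).g v = (P.transform φ).g (φ p)) →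
    (∀ᶠ v in 𝓝 (φ p), (P.transform φ).b v = 0) ∨ (P.transform φ).b (φ p) ≠ 0

/-- The operator `-P`. -/
def neg (P : DNOperator 𝕜 n) : DNOperator 𝕜 n where
  g u := -P.g u
  b u := -P.b u

/-- The constant form, with matrix `d/dx, 0; 0, 0`. -/
def constForm (𝕜 : Type*) [RCLike 𝕜] : DNOperator 𝕜 2 where
  g _ := !![1, 0; 0, 0]
  b _ := 0

/-- The non-constant form, with matrix `d/dx, -u²_x/u¹; u²_x/u¹, 0`, where `u¹ ≠ 0`
(the components `u¹, u²` are `u 0, u 1`). -/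
def nonconstForm (𝕜 : Type*) [RCLike 𝕜] : DNOperator 𝕜 2 where
  g _ := !![1, 0; 0, 0]
  b u := fun i j k => if k = 1 then !![0, -(1 / u 0); 1 / u 0, 0] i j else 0

end DNOperator

end

/-! Testing skew-symmetry and the Jacobi identity on the functionals with densities `(u^i - c)² / 2`
and `p(x) u^j` yields the coefficient conditions collected in `IsPoissonOn`: `g` is symmetric, `∂_k
g^{ij} = b^{ij}_k + b^{ji}_k`, a symmetry of `b` contracted with `g`, and a flatness identity. They
are read off by means of `IntegralEqZero.deriv_eq_fderiv`, which is the Euler-Lagrange equation of a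
total derivative evaluated on jets with constant `u`.

Where `g` vanishes on an open set, flatness forces `b = 0`. Where `g ≠ 0`, degeneracy and symmetry
leave a nonzero diagonal entry; a smooth square root of it, up to a sign needed only over `ℝ`,
writes `±g = v ⊗ v`. The remaining conditions then determine `b` up to one function `μ`: `b^{ij}_k =
v^i ∂_k v^j + μ n_k ε^{ij}`, where `n` annihilates `v` and `ε` is the standard skew matrix, and
flatness reduces to the Riccati equation `v(μ) = μ²` (`IsPoissonOn.exists_hasRankOneForm`).

In variables rectifying `v`, only the `μ` term of `b` survives. If `μ` vanishes near the point, this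
is the constant form. If `μ ≠ 0`, then `v(-1/μ) = v(μ)/μ² = 1`, so `-1/μ` serves as the coordinate
along `v`; together with a first integral of `v` it gives the second form, with coefficient `μ =
-1/u¹`.

In every chart where `g` is constant, `b` vanishes exactly where `μ` does. Hence, where `g ≠ 0`,
regularity means that `μ` vanishes near `p` or is nonzero at `p`, and density follows at once.

Rectification needs a flow with time in `𝕜`, smooth or holomorphic in time and initial point
together. It is obtained uniformly for both fields from the implicit function theorem on the Banach
space of continuous curves, where superposition by a smooth map is smooth. -/

/-! ### Smoothness of superposition operators on spaces of continuous maps. -/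

section Superposition

universe u

variable {𝕜 : Type*} [RCLike 𝕜] {E F : Type u} [NormedAddCommGroup E] [NormedSpace 𝕜 E]
  [NormedAddCommGroup F] [NormedSpace 𝕜 F] {K : Type*} [TopologicalSpace K]

open Classical in
/-- The superposition (Nemytskii) operator `γ ↦ f ∘ γ` between spaces of continuous maps. -/
noncomputable def superposition (f : E → F) (γ : C(K, E)) : C(K, F) :=
  -- The value zero only makes the operator total; it is never met on curves lying in a set where
  -- `f` is continuous.
  if h : Continuous (f ∘ γ) then ⟨f ∘ γ, h⟩ else 0

theorem superposition_apply {f : E → F} {U : Set E} (hf : ContinuousOn f U) {γ : C(K, E)}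
    (hγ : ∀ s, γ s ∈ U) (s : K) : superposition f γ s = f (γ s) := by
  have h : Continuous (f ∘ γ) := hf.comp_continuous γ.continuous hγ
  simp [superposition, h]

variable [CompactSpace K]

theorem isOpen_setOf_forall_mem {U : Set E} (hU : IsOpen U) :
    IsOpen {γ : C(K, E) | ∀ s, γ s ∈ U} := by
  have := ContinuousMap.isOpen_setOfPred_mapsTo (X := K) (isCompact_univ) hU
  simpa [Set.MapsTo] using this

theorem continuousOn_superposition {f : E → F} {U : Set E} (hf : ContinuousOn f U) :
    ContinuousOn (superposition f : C(K, E) → C(K, F)) {γ | ∀ s, γ s ∈ U} := by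
  rw [continuousOn_iff_continuous_domRestrict]
  apply ContinuousMap.continuous_of_continuous_uncurry
  have : (Function.uncurry fun (γ : {γ : C(K, E) | ∀ s, γ s ∈ U}) (s : K) =>
      (({γ : C(K, E) | ∀ s, γ s ∈ U}.domRestrict (superposition f)) γ) s)
      = fun z => f (z.1.1 z.2) := by
    ext z
    exact superposition_apply hf z.1.2 z.2
  rw [this]
  exact hf.comp_continuous (by fun_prop) fun z => z.1.2 z.2

variable (𝕜 E F K) in
/-- The pointwise application of a continuous family of operators, as a bilinear map. -/
noncomputable def pointwiseApply : C(K, E →L[𝕜] F) →L[𝕜] C(K, E) →L[𝕜] C(K, F) :=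
  LinearMap.mkContinuous₂
    (LinearMap.mk₂ 𝕜
      (fun (A : C(K, E →L[𝕜] F)) (η : C(K, E)) =>
        (⟨fun s => A s (η s), by fun_prop⟩ : C(K, F)))
      (fun A A' η => by ext s; simp) (fun c A η => by ext s; simp)
      (fun A η η' => by ext s; simp) (fun c A η => by ext s; simp)) 1 (by
    intro A η
    refine (ContinuousMap.norm_le _ (by positivity)).2 fun s => ?_
    rw [one_mul]
    exact ((A s).le_opNorm _).trans
      (mul_le_mul (A.norm_coe_le_norm s) (η.norm_coe_le_norm s) (norm_nonneg _)
        ((norm_nonneg _).trans (A.norm_coe_le_norm s))))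

theorem pointwiseApply_apply (A : C(K, E →L[𝕜] F)) (η : C(K, E)) (s : K) :
    pointwiseApply 𝕜 E F K A η s = A s (η s) := rfl

theorem norm_pointwiseApply_le (A : C(K, E →L[𝕜] F)) (η : C(K, E)) :
    ‖pointwiseApply 𝕜 E F K A η‖ ≤ ‖A‖ * ‖η‖ := by
  rw [ContinuousMap.norm_le _ (by positivity)]
  intro s
  exact ((A s).le_opNorm _).trans
    (mul_le_mul (A.norm_coe_le_norm s) (η.norm_coe_le_norm s) (norm_nonneg _)
        ((norm_nonneg _).trans (A.norm_coe_le_norm s)))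

theorem hasFDerivAt_superposition {f : E → F} {U : Set E} (hU : IsOpen U)
    (hf : DifferentiableOn 𝕜 f U) (hf' : ContinuousOn (fderiv 𝕜 f) U) {γ : C(K, E)}
    (hγ : ∀ s, γ s ∈ U) :
    HasFDerivAt (superposition f : C(K, E) → C(K, F))
      (pointwiseApply 𝕜 E F K (superposition (fderiv 𝕜 f) γ)) γ := by
  rw [hasFDerivAt_iff_isLittleO_nhds_zero, Asymptotics.isLittleO_iff]
  intro ε hε
  have hO := isOpen_setOf_forall_mem (K := K) hU
  have hcont : ContinuousAt (superposition (fderiv 𝕜 f) : C(K, E) → C(K, E →L[𝕜] F)) γ :=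
    (continuousOn_superposition hf').continuousAt (hO.mem_nhds hγ)
  obtain ⟨δ, hδ, hball⟩ := Metric.eventually_nhds_iff.1
    ((hO.eventually_mem hγ).and (Metric.tendsto_nhds.1 hcont ε hε))
  filter_upwards [Metric.ball_mem_nhds (0 : C(K, E)) hδ] with h hh
  have hh' : ‖h‖ < δ := by simpa using hh
  have hmemU : ∀ s, ∀ y ∈ Metric.ball (γ s) δ,
      y ∈ U ∧ ‖fderiv 𝕜 f y - fderiv 𝕜 f (γ s)‖ ≤ ε := by
    intro s y hy
    have hy' : ‖y - γ s‖ < δ := by simpa [dist_eq_norm] using hy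
    -- Translating the whole curve by a constant moves its value at `s` to `y`, so sup-norm
    -- continuity of the superposed derivative gives a bound with the same `δ` for all `s`. The mean
    -- value inequality on these balls then applies uniformly.
    have hd : dist (γ + ContinuousMap.const K (y - γ s)) γ < δ := by
      rw [dist_eq_norm, add_sub_cancel_left, ContinuousMap.norm_lt_iff _ hδ]
      intro _
      exact hy'
    obtain ⟨h1, h2⟩ := hball hd
    have hys : (γ + ContinuousMap.const K (y - γ s)) s = y := by simp
    refine ⟨hys ▸ h1 s, ?_⟩
    have h3 := (ContinuousMap.dist_apply_le_dist
      (f := superposition (fderiv 𝕜 f) (γ + ContinuousMap.const K (y - γ s)))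
      (g := superposition (fderiv 𝕜 f) γ) s).trans h2.le
    rwa [superposition_apply hf' h1, superposition_apply hf' hγ, hys, dist_eq_norm] at h3
  have hγh : ∀ s, (γ + h) s ∈ U := fun s => (hmemU s _ (by
    simpa [dist_eq_norm] using (h.norm_coe_le_norm s).trans_lt hh')).1
  rw [ContinuousMap.norm_le _ (by positivity)]
  intro s
  simp only [ContinuousMap.sub_apply, pointwiseApply_apply]
  rw [superposition_apply hf.continuousOn hγh, superposition_apply hf.continuousOn hγ,
    superposition_apply hf' hγ]
  let _ : NormedSpace ℝ E := NormedSpace.restrictScalars ℝ 𝕜 E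
  have := Convex.norm_image_sub_le_of_norm_hasFDerivWithin_le' (𝕜 := 𝕜) (f := f)
    (f' := fderiv 𝕜 f) (s := Metric.ball (γ s) δ) (φ := fderiv 𝕜 f (γ s)) (C := ε)
    (x := γ s) (y := (γ + h) s)
    (fun y hy =>
      ((hf.differentiableAt (hU.mem_nhds (hmemU s y hy).1)).hasFDerivAt).hasFDerivWithinAt)
    (fun y hy => (hmemU s y hy).2) (convex_ball _ _) (Metric.mem_ball_self hδ) (by
      simpa [dist_eq_norm] using (h.norm_coe_le_norm s).trans_lt hh')
  simp only [ContinuousMap.add_apply, add_sub_cancel_left] at this ⊢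
  exact this.trans (mul_le_mul_of_nonneg_left (h.norm_coe_le_norm s) hε.le)

/-- The derivative at `γ` is pointwise application of `fderiv 𝕜 f ∘ γ`, again a superposition
operator, so differentiability climbs by induction. The target varies inside the induction because
the derivative takes values in `E →L[𝕜] F`; a common universe for `E` and `F` keeps that space in
the same one. -/
theorem contDiffOn_superposition_nat (n : ℕ) : ∀ {F : Type u} [NormedAddCommGroup F]
    [NormedSpace 𝕜 F] {f : E → F} {U : Set E}, IsOpen U → ContDiffOn 𝕜 n f U →
    ContDiffOn 𝕜 n (superposition f : C(K, E) → C(K, F)) {γ | ∀ s, γ s ∈ U} := by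
  induction n with
  | zero =>
    intro F _ _ f U _ hf
    simp only [Nat.cast_zero, contDiffOn_zero] at *
    exact continuousOn_superposition hf
  | succ n ih =>
    intro F _ _ f U hU hf
    have hO := isOpen_setOf_forall_mem (K := K) hU
    push_cast at hf ⊢
    obtain ⟨hd, -, hf'⟩ := (contDiffOn_succ_iff_fderiv_of_isOpen hU).1 hf
    rw [contDiffOn_succ_iff_hasFDerivWithinAt_of_uniqueDiffOn hO.uniqueDiffOn]
    have hp : ContDiff 𝕜 n (pointwiseApply 𝕜 E F K) :=
      ContinuousLinearMap.contDiff (𝕜 := 𝕜) (E := C(K, E →L[𝕜] F))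
        (F := C(K, E) →L[𝕜] C(K, F)) (pointwiseApply 𝕜 E F K)
    refine ⟨by simp, fun γ => pointwiseApply 𝕜 E F K (superposition (fderiv 𝕜 f) γ),
      hp.comp_contDiffOn (ih hU hf'), fun γ hγ =>
      (hasFDerivAt_superposition hU hd hf'.continuousOn hγ).hasFDerivWithinAt⟩

theorem contDiffOn_superposition {f : E → F} {U : Set E} (hU : IsOpen U)
    (hf : ContDiffOn 𝕜 ∞ f U) :
    ContDiffOn 𝕜 ∞ (superposition f : C(K, E) → C(K, F)) {γ | ∀ s, γ s ∈ U} :=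
  contDiffOn_infty.2 fun n => contDiffOn_superposition_nat n hU (contDiffOn_infty.1 hf n)

end Superposition

/-! ### Charts from the inverse function theorem. -/

section Chart

variable {𝕜 : Type*} [RCLike 𝕜]

/-- A smooth map with invertible differential at `p` is a smooth chart near `p`. -/
theorem exists_chart_of_equiv {E : Type*} [NormedAddCommGroup E] [NormedSpace 𝕜 E] [CompleteSpace E]
    {y : E → E} {V : Set E} (hV : IsOpen V) (hy : ContDiffOn 𝕜 ∞ y V) {p : E} (hp : p ∈ V)
    (e : E ≃L[𝕜] E) (he : (e : E →L[𝕜] E) = fderiv 𝕜 y p) :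
    ∃ φ : OpenPartialHomeomorph E E, p ∈ φ.source ∧ φ.source ⊆ V ∧
      ContDiffOn 𝕜 ∞ φ φ.source ∧ ContDiffOn 𝕜 ∞ φ.symm φ.target ∧ ⇑φ = y := by
  have hy1 : ContDiffOn 𝕜 1 y V := hy.of_le (by exact_mod_cast le_top)
  have hc := hy1.continuousOn_fderiv_of_isOpen hV le_rfl
  -- Invertible operators form an open set; on `W` the differential is invertible at every point,
  -- which makes the inverse smooth on the whole target and not only at the image of `p`.
  let W : Set E := V ∩ fderiv 𝕜 y ⁻¹' Set.range ((↑) : (E ≃L[𝕜] E) → E →L[𝕜] E)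
  have hW : IsOpen W := hc.isOpen_inter_preimage hV ContinuousLinearEquiv.isOpen
  have hpW : p ∈ W := ⟨hp, e, he⟩
  have hyp : ContDiffAt 𝕜 ∞ y p := hy.contDiffAt (hV.mem_nhds hp)
  have hd : HasFDerivAt y (e : E →L[𝕜] E) p := by
    rw [he]
    exact (hyp.differentiableAt (by simp)).hasFDerivAt
  let φ := (hyp.toOpenPartialHomeomorph y hd (by simp)).restrOpen W hW
  refine ⟨φ, ⟨hyp.mem_toOpenPartialHomeomorph_source hd (by simp), hpW⟩, fun u hu => hu.2.1,
    hy.mono fun u hu => hu.2.1, ?_, rfl⟩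
  intro x hx
  have hxs : φ.symm x ∈ φ.source := φ.map_target hx
  obtain ⟨e', he'⟩ := hxs.2.2
  have hyx : ContDiffAt 𝕜 ∞ y (φ.symm x) := hy.contDiffAt (hV.mem_nhds hxs.2.1)
  refine (φ.contDiffAt_symm (f₀' := e') hx ?_ hyx).contDiffWithinAt
  rw [he']
  exact (hyx.differentiableAt (by simp)).hasFDerivAt

end Chart

/-! ### Local flows with time in the field, via the implicit function theorem. -/

section Flow

universe u

variable {𝕜 : Type*} [RCLike 𝕜] {E : Type u} [NormedAddCommGroup E] [NormedSpace 𝕜 E]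

theorem continuous_comp_projIcc (γ : C(unitInterval, E)) :
    Continuous fun r : ℝ => γ (Set.projIcc 0 1 zero_le_one r) :=
  γ.continuous.comp continuous_projIcc

variable [NormedSpace ℝ E] [IsScalarTower ℝ 𝕜 E]

variable (𝕜 E) in
/-- The operator `γ ↦ (s ↦ ∫ r in 0..s, γ r)` on continuous curves. -/
noncomputable def primitive : C(unitInterval, E) →L[𝕜] C(unitInterval, E) :=
  LinearMap.mkContinuous
    { toFun := fun γ => ⟨fun s => ∫ r in (0 : ℝ)..s, γ (Set.projIcc 0 1 zero_le_one r),
        (intervalIntegral.continuous_primitive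
          (fun a b => (continuous_comp_projIcc γ).intervalIntegrable a b) 0).comp
          continuous_subtype_val⟩
      map_add' := fun γ η => by
        ext s
        exact intervalIntegral.integral_add ((continuous_comp_projIcc γ).intervalIntegrable _ _)
          ((continuous_comp_projIcc η).intervalIntegrable _ _)
      map_smul' := fun c γ => by
        ext s
        exact intervalIntegral.integral_smul c _ } 1 (by
    intro γ
    refine (ContinuousMap.norm_le _ (by positivity)).2 fun s => ?_
    have h := intervalIntegral.norm_integral_le_of_norm_le_const (a := 0) (b := s)
      (f := fun r => γ (Set.projIcc 0 1 zero_le_one r)) (C := ‖γ‖)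
      fun r _ => γ.norm_coe_le_norm _
    refine h.trans ?_
    rw [sub_zero, abs_of_nonneg s.2.1, one_mul]
    exact mul_le_of_le_one_right (norm_nonneg _) s.2.2)

theorem primitive_apply (γ : C(unitInterval, E)) (s : unitInterval) :
    primitive 𝕜 E γ s = ∫ r in (0 : ℝ)..s, γ (Set.projIcc 0 1 zero_le_one r) := rfl

theorem norm_primitive_le (γ : C(unitInterval, E)) : ‖primitive 𝕜 E γ‖ ≤ ‖γ‖ := by
  have := (primitive 𝕜 E).le_of_opNorm_le (LinearMap.mkContinuous_norm_le _ zero_le_one _) γ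
  simpa using this

/-- The curve `s ↦ s • v (γ s)`. -/
noncomputable def scaledVelocity (v : E → E) (γ : C(unitInterval, E)) : C(unitInterval, E) :=
  ⟨fun s => (s : ℝ) • superposition v γ s, by fun_prop⟩

/-- If `γ` solves `γ' = τ v(γ)`, the curve `s ↦ s • v (γ s)` solves the equation
linearised at `τ`. -/
theorem scaledVelocity_eq [CompleteSpace E] {v : E → E} {U : Set E} (hU : IsOpen U)
    (hv : DifferentiableOn 𝕜 v U) (hv' : ContinuousOn (fderiv 𝕜 v) U) {γ : C(unitInterval, E)}
    (hγ : ∀ s, γ s ∈ U) {x : E} {τ : 𝕜}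
    (h : γ = ContinuousMap.const _ x + τ • primitive 𝕜 E (superposition v γ)) :
    scaledVelocity v γ = primitive 𝕜 E (superposition v γ) +
      τ • primitive 𝕜 E (pointwiseApply 𝕜 E E _ (superposition (fderiv 𝕜 v) γ)
        (scaledVelocity v γ)) := by
  ext s
  set π : ℝ → unitInterval := Set.projIcc 0 1 zero_le_one with hπ
  have hc : Continuous fun r => superposition v γ (π r) := continuous_comp_projIcc _
  have hA := continuous_comp_projIcc (pointwiseApply 𝕜 E E _ (superposition (fderiv 𝕜 v) γ)
        (scaledVelocity v γ))
  have hA' : Continuous fun r => τ • pointwiseApply 𝕜 E E _ (superposition (fderiv 𝕜 v) γ)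
        (scaledVelocity v γ) (π r) := hA.const_smul τ
  -- `Γ` extends the solution curve differentiably past the endpoints of the unit interval, so that
  -- two-sided derivatives exist there and the fundamental theorem of calculus applies to `r • v (Γ
  -- r)`.
  let Γ : ℝ → E := fun r => x + τ • ∫ t in (0 : ℝ)..r, superposition v γ (π t)
  have hπr : ∀ r ∈ Set.Icc (0 : ℝ) 1, π r = r := fun r hr => by
    rw [hπ, Set.projIcc_of_mem _ hr]
  have hΓ : ∀ r ∈ Set.Icc (0 : ℝ) 1, Γ r = γ (π r) := by
    intro r hr
    have := DFunLike.congr_fun h (π r)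
    simp only [ContinuousMap.add_apply, ContinuousMap.const_apply, ContinuousMap.smul_apply,
      primitive_apply] at this
    rw [this, hπr r hr]
  have hdΓ : ∀ r, HasDerivAt Γ (τ • superposition v γ (π r)) r := fun r =>
    ((intervalIntegral.integral_hasDerivAt_right (hc.intervalIntegrable _ _)
      (hc.stronglyMeasurableAtFilter _ _) hc.continuousAt).const_smul τ).const_add x
  have hdv : ∀ r ∈ Set.Icc (0 : ℝ) 1, HasDerivAt (fun r : ℝ => r • v (Γ r))
      (superposition v γ (π r) + τ • pointwiseApply 𝕜 E E _ (superposition (fderiv 𝕜 v) γ)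
        (scaledVelocity v γ) (π r)) r := by
    intro r hr
    have h1 : HasFDerivAt v (fderiv 𝕜 v (Γ r)) (Γ r) :=
      (hv.differentiableAt (hU.mem_nhds (by rw [hΓ r hr]; exact hγ _))).hasFDerivAt
    have h2 := (h1.restrictScalars ℝ).comp_hasDerivAt r (hdΓ r)
    have h3 := (hasDerivAt_id r).smul h2
    refine h3.congr_deriv ?_
    simp only [pointwiseApply_apply, scaledVelocity, ContinuousMap.coe_mk,
      superposition_apply hv.continuousOn hγ, superposition_apply hv' hγ, id,
      ContinuousLinearMap.coe_restrictScalars', map_smul, hπr r hr, hΓ r hr, one_smul,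
      Function.comp_apply]
    rw [add_comm]
    congr 1
    rw [(fderiv 𝕜 v (γ (π r))).map_smul_of_tower, smul_comm]
  have hint := intervalIntegral.integral_eq_sub_of_hasDerivAt (a := 0) (b := (s : ℝ))
    (fun r hr => hdv r (by
      rw [Set.uIcc_of_le s.2.1] at hr
      exact ⟨hr.1, hr.2.trans s.2.2⟩))
    ((hc.add hA').intervalIntegrable _ _)
  rw [intervalIntegral.integral_add (hc.intervalIntegrable _ _)
    (hA'.intervalIntegrable _ _), intervalIntegral.integral_smul, zero_smul,
    sub_zero, hΓ s s.2] at hint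
  have hs : π s = s := Subtype.ext (hπr s s.2)
  rw [hs] at hint
  simp only [ContinuousMap.add_apply, ContinuousMap.smul_apply, primitive_apply]
  rw [hint]
  simp [scaledVelocity, superposition_apply hv.continuousOn hγ]

/-- A smooth (holomorphic) vector field has a local flow, with time in the field `𝕜`, which is
smooth in the time and in the initial point. -/
theorem exists_local_flow [CompleteSpace E] {v : E → E} {U : Set E} (hU : IsOpen U)
    (hv : ContDiffOn 𝕜 ∞ v U) {p : E} (hp : p ∈ U) :
    ∃ (Φ : 𝕜 × E → E) (Ω : Set (𝕜 × E)), IsOpen Ω ∧ ((0 : 𝕜), p) ∈ Ω ∧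
      ContDiffOn 𝕜 ∞ Φ Ω ∧ (∀ x, ((0 : 𝕜), x) ∈ Ω → Φ (0, x) = x) ∧
      ∀ z ∈ Ω, Φ z ∈ U ∧ HasDerivAt (fun τ => Φ (τ, z.2)) (v (Φ z)) z.1 := by
  -- A zero of `G` over `(τ, x)` solves `γ(s) = x + τ ∫₀ˢ v(γ)`, so `γ(s)` is the flow at time `τ
  -- s`. Rescaling puts time among the parameters, where it may be complex. At `τ = 0` the partial
  -- derivative in `γ` is the identity.
  let G : (𝕜 × E) × C(unitInterval, E) → C(unitInterval, E) := fun y =>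
    y.2 - ContinuousLinearMap.const 𝕜 unitInterval y.1.2
      - y.1.1 • primitive 𝕜 E (superposition v y.2)
  let γ₀ : C(unitInterval, E) := ContinuousMap.const _ p
  have hO := isOpen_setOf_forall_mem (K := unitInterval) hU
  have hγ₀ : γ₀ ∈ {γ : C(unitInterval, E) | ∀ s, γ s ∈ U} := fun _ => hp
  let O : Set ((𝕜 × E) × C(unitInterval, E)) := {y | ∀ s, y.2 s ∈ U}
  have hOo : IsOpen O := hO.preimage continuous_snd
  have hGO : ContDiffOn 𝕜 ∞ G O := by
    have h1 : ContDiffOn 𝕜 ∞ (fun y : (𝕜 × E) × C(unitInterval, E) => superposition v y.2) O :=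
      (contDiffOn_superposition hU hv).comp contDiffOn_snd fun y hy => hy
    have hc : ContDiff 𝕜 ∞ (ContinuousLinearMap.const 𝕜 unitInterval : E →L[𝕜] _) :=
      ContinuousLinearMap.contDiff (𝕜 := 𝕜) (E := E) (F := C(unitInterval, E)) _
    have hJ : ContDiff 𝕜 ∞ (primitive 𝕜 E) :=
      ContinuousLinearMap.contDiff (𝕜 := 𝕜) (E := C(unitInterval, E))
        (F := C(unitInterval, E)) _
    exact (contDiff_snd.sub (hc.comp (contDiff_snd.comp contDiff_fst))).contDiffOn.sub
      ((contDiff_fst.comp contDiff_fst).contDiffOn.smul (hJ.comp_contDiffOn h1))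
  have hy₀ : (((0 : 𝕜), p), γ₀) ∈ O := fun _ => hp
  have hG : ContDiffAt 𝕜 ∞ G (((0 : 𝕜), p), γ₀) := hGO.contDiffAt (hOo.mem_nhds hy₀)
  have hinr : fderiv 𝕜 G (((0 : 𝕜), p), γ₀) ∘L
      ContinuousLinearMap.inr 𝕜 (𝕜 × E) C(unitInterval, E) = ContinuousLinearMap.id 𝕜 _ := by
    have h1 := (hG.differentiableAt (by simp)).hasFDerivAt
    have h2 : HasFDerivAt (fun γ : C(unitInterval, E) => (((0 : 𝕜), p), γ))
        (ContinuousLinearMap.inr 𝕜 (𝕜 × E) C(unitInterval, E)) γ₀ :=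
      hasFDerivAt_prodMk_right _ _
    have h3 := h1.comp γ₀ h2
    have h4 : HasFDerivAt (G ∘ fun γ : C(unitInterval, E) => (((0 : 𝕜), p), γ))
        (ContinuousLinearMap.id 𝕜 _) γ₀ := by
      have : (G ∘ fun γ : C(unitInterval, E) => (((0 : 𝕜), p), γ))
          = fun γ => γ - ContinuousLinearMap.const 𝕜 unitInterval p := by
        ext1 γ
        simp [G]
      rw [this]
      exact (hasFDerivAt_id γ₀).sub_const _
    exact h3.unique h4
  let H : (𝕜 × E) × C(unitInterval, E) → (𝕜 × E) × C(unitInterval, E) := fun y => (y.1, G y)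
  have hH : ContDiffOn 𝕜 ∞ H O := contDiffOn_fst.prodMk hGO
  let e : ((𝕜 × E) × C(unitInterval, E)) ≃L[𝕜] (𝕜 × E) × C(unitInterval, E) :=
    (ContinuousLinearEquiv.refl 𝕜 (𝕜 × E)).skewProd (ContinuousLinearEquiv.refl 𝕜 _)
      (fderiv 𝕜 G (((0 : 𝕜), p), γ₀) ∘L ContinuousLinearMap.inl 𝕜 (𝕜 × E) C(unitInterval, E))
  have he : (e : ((𝕜 × E) × C(unitInterval, E)) →L[𝕜] (𝕜 × E) × C(unitInterval, E))
      = fderiv 𝕜 H (((0 : 𝕜), p), γ₀) := by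
    have h1 : HasFDerivAt H _ (((0 : 𝕜), p), γ₀) :=
      hasFDerivAt_fst.prodMk (hG.differentiableAt (by simp)).hasFDerivAt
    rw [h1.fderiv]
    refine ContinuousLinearMap.ext fun y => ?_
    have h2 : fderiv 𝕜 G (((0 : 𝕜), p), γ₀) ((0 : 𝕜 × E), y.2) = y.2 :=
      DFunLike.congr_fun hinr y.2
    have h3 : y = (y.1, 0) + ((0 : 𝕜 × E), y.2) := by simp
    refine Prod.ext rfl ?_
    change y.2 + fderiv 𝕜 G (((0 : 𝕜), p), γ₀) (y.1, 0) = fderiv 𝕜 G (((0 : 𝕜), p), γ₀) y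
    conv_rhs => rw [h3, map_add, h2, add_comm]
  obtain ⟨φ, hφ0, hφO, -, hφs, hφH⟩ := exists_chart_of_equiv hOo hH hy₀ e he
  have hH0 : H (((0 : 𝕜), p), γ₀) = (((0 : 𝕜), p), 0) := by
    refine Prod.ext rfl ?_
    ext s
    simp [H, G, γ₀]
  let ι : 𝕜 × E → (𝕜 × E) × C(unitInterval, E) := fun z => (z, 0)
  have hι : ContDiff 𝕜 ∞ ι := contDiff_id.prodMk contDiff_const
  let Ω₀ : Set (𝕜 × E) := ι ⁻¹' φ.target
  have hΩ₀ : IsOpen Ω₀ := φ.open_target.preimage hι.continuous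
  have hpΩ₀ : ((0 : 𝕜), p) ∈ Ω₀ := by
    have := φ.map_source hφ0
    rwa [hφH, hH0] at this
  let Γ : 𝕜 × E → C(unitInterval, E) := fun z => (φ.symm (ι z)).2
  have hΓ : ContDiffOn 𝕜 ∞ Γ Ω₀ := contDiff_snd.comp_contDiffOn
    (hφs.comp hι.contDiffOn fun z hz => hz)
  have hΓp : Γ ((0 : 𝕜), p) = γ₀ := by
    have := φ.left_inv hφ0
    rw [hφH, hH0] at this
    simp only [Γ, ι, this]
  have hsol : ∀ z ∈ Ω₀,
      Γ z = ContinuousMap.const _ z.2 + z.1 • primitive 𝕜 E (superposition v (Γ z)) := by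
    intro z hz
    have h1 := φ.right_inv hz
    rw [hφH] at h1
    have h2 : (φ.symm (ι z)).1 = z := congrArg Prod.fst h1
    have h3 : Γ z - ContinuousMap.const _ (φ.symm (ι z)).1.2
        - (φ.symm (ι z)).1.1 • primitive 𝕜 E (superposition v (Γ z)) = 0 := congrArg Prod.snd h1
    rw [h2, sub_sub, sub_eq_zero] at h3
    exact h3
  have hUΓ : ∀ z ∈ Ω₀, ∀ s, Γ z s ∈ U := fun z hz => hφO (φ.map_target hz)
  have hΓc : ContinuousOn Γ Ω₀ := hΓ.continuousOn
  let ev : C(unitInterval, E) →L[𝕜] E := ContinuousMap.evalCLM 𝕜 1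
  have hevc : ContDiff 𝕜 ∞ ev :=
    ContinuousLinearMap.contDiff (𝕜 := 𝕜) (E := C(unitInterval, E)) (F := E) _
  have hv1 : ContDiffOn 𝕜 1 v U := hv.of_le (by exact_mod_cast le_top)
  have hvd : DifferentiableOn 𝕜 v U := hv1.differentiableOn (by simp)
  have hv' : ContinuousOn (fderiv 𝕜 v) U := hv1.continuousOn_fderiv_of_isOpen hU le_rfl
  -- Where this is below one, the equation linearised along the solution is a contraction. Its
  -- unique solution is both the `τ`-derivative of the curve and `s ↦ s • v (γ s)`; at `s = 1` this
  -- is the flow equation.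
  let N : 𝕜 × E → ℝ := fun z => ‖z.1‖ * ‖superposition (fderiv 𝕜 v) (Γ z)‖
  have hN : ContinuousOn N Ω₀ := continuous_fst.norm.continuousOn.mul
    (((continuousOn_superposition hv').comp hΓc hUΓ).norm)
  refine ⟨fun z => ev (Γ z), Ω₀ ∩ N ⁻¹' Set.Iio 1, hN.isOpen_inter_preimage hΩ₀ isOpen_Iio,
    ⟨hpΩ₀, by simp [N]⟩, (hevc.comp_contDiffOn hΓ).mono Set.inter_subset_left, ?_, ?_⟩
  · intro x hx
    simp only
    rw [hsol _ hx.1]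
    simp [ev]
  · rintro z ⟨hz0, hz1⟩
    have hzU := hUΓ z hz0
    have hzd : DifferentiableAt 𝕜 Γ z :=
      (hΓ.contDiffAt (hΩ₀.mem_nhds hz0)).differentiableAt (by simp)
    have hzs : ∀ᶠ z' in 𝓝 z, Γ z' = ContinuousMap.const _ z'.2
        + z'.1 • primitive 𝕜 E (superposition v (Γ z')) :=
      (hΩ₀.eventually_mem hz0).mono hsol
    have hz1' : ‖z.1‖ * ‖superposition (fderiv 𝕜 v) (Γ z)‖ < 1 := hz1
    refine ⟨hzU 1, ?_⟩
    have hτ : HasDerivAt (fun τ : 𝕜 => (τ, z.2)) ((1 : 𝕜), (0 : E)) z.1 :=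
      (hasDerivAt_id z.1).prodMk (hasDerivAt_const z.1 z.2)
    have hd := HasFDerivAt.comp_hasDerivAt (f := fun τ : 𝕜 => (τ, z.2)) (l := Γ) z.1
      hzd.hasFDerivAt hτ
    set c' := fderiv 𝕜 Γ z ((1 : 𝕜), (0 : E)) with hc'
    have hJF : HasFDerivAt (primitive 𝕜 E) (primitive 𝕜 E) (superposition v (Γ z)) :=
      ContinuousLinearMap.hasFDerivAt (𝕜 := 𝕜) (E := C(unitInterval, E))
        (F := C(unitInterval, E)) _
    have hrhs : HasDerivAt (fun τ => ContinuousMap.const unitInterval z.2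
        + τ • primitive 𝕜 E (superposition v (Γ (τ, z.2))))
        (primitive 𝕜 E (superposition v (Γ z)) + z.1 • primitive 𝕜 E
          (pointwiseApply 𝕜 E E _ (superposition (fderiv 𝕜 v) (Γ z)) c')) z.1 := by
      have h1 := HasFDerivAt.comp_hasDerivAt (l := superposition v) z.1
        (hasFDerivAt_superposition hU hvd hv' hzU) hd
      have h2 := HasFDerivAt.comp_hasDerivAt (l := primitive 𝕜 E) z.1 hJF h1
      have h3 := ((hasDerivAt_id z.1).smul h2).const_add (ContinuousMap.const unitInterval z.2)
      refine h3.congr_deriv ?_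
      simp only [id, one_smul, Function.comp_apply]
      rw [add_comm]
    have heq : c' = primitive 𝕜 E (superposition v (Γ z)) + z.1 • primitive 𝕜 E
          (pointwiseApply 𝕜 E E _ (superposition (fderiv 𝕜 v) (Γ z)) c') := by
      refine hd.unique (hrhs.congr_of_eventuallyEq ?_)
      have h1 : Filter.Tendsto (fun τ : 𝕜 => (τ, z.2)) (𝓝 z.1) (𝓝 z) :=
        (Continuous.prodMk_left z.2).tendsto z.1
      exact h1.eventually hzs
    have hκ := scaledVelocity_eq hU hvd hv' hzU hzs.self_of_nhds
    have hzero : c' = scaledVelocity v (Γ z) := by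
      set A := superposition (fderiv 𝕜 v) (Γ z)
      have h1 : c' - scaledVelocity v (Γ z) = z.1 • primitive 𝕜 E
          (pointwiseApply 𝕜 E E _ A (c' - scaledVelocity v (Γ z))) := by
        rw [map_sub, map_sub, smul_sub]
        nth_rewrite 1 [heq, hκ]
        abel
      have h2 : ‖c' - scaledVelocity v (Γ z)‖ ≤ (‖z.1‖ * ‖A‖) * ‖c' - scaledVelocity v (Γ z)‖ := by
        nth_rewrite 1 [h1]
        rw [norm_smul, mul_assoc]
        exact mul_le_mul_of_nonneg_left ((norm_primitive_le _).trans (norm_pointwiseApply_le _ _))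
          (norm_nonneg _)
      have h3 : ‖c' - scaledVelocity v (Γ z)‖ = 0 := by
        nlinarith [norm_nonneg (c' - scaledVelocity v (Γ z))]
      exact sub_eq_zero.1 (norm_eq_zero.1 h3)
    have hev : HasFDerivAt ev ev (Γ z) :=
      ContinuousLinearMap.hasFDerivAt (𝕜 := 𝕜) (E := C(unitInterval, E)) (F := E) _
    have hfin := HasFDerivAt.comp_hasDerivAt (l := ev) z.1 hev hd
    refine hfin.congr_deriv ?_
    rw [hzero]
    simp [ev, scaledVelocity, superposition_apply hvd.continuousOn hzU]

end Flow

/-! ### Local square roots and the flow box. -/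

section Charts

variable {𝕜 : Type*} [RCLike 𝕜]

theorem exists_chart {E : Type*} [NormedAddCommGroup E] [NormedSpace 𝕜 E] [FiniteDimensional 𝕜 E]
    {y : E → E} {V : Set E} (hV : IsOpen V) (hy : ContDiffOn 𝕜 ∞ y V) {p : E} (hp : p ∈ V)
    (hinj : Function.Injective (fderiv 𝕜 y p)) :
    ∃ φ : OpenPartialHomeomorph E E, p ∈ φ.source ∧ φ.source ⊆ V ∧
      ContDiffOn 𝕜 ∞ φ φ.source ∧ ContDiffOn 𝕜 ∞ φ.symm φ.target ∧ ⇑φ = y := by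
  have : CompleteSpace E := FiniteDimensional.complete 𝕜 E
  exact exists_chart_of_equiv hV hy hp
    (LinearEquiv.ofInjectiveEndo (fderiv 𝕜 y p : E →ₗ[𝕜] E) hinj).toContinuousLinearEquiv
    (by ext x; rfl)

/-- Over `ℝ`, characterised by `RCLike.I = 0`, one of `z` and `-z` is a square; over `ℂ` every
number is, and no sign is needed. -/
theorem exists_sq_eq_or_neg (z : 𝕜) :
    ∃ ε r : 𝕜, (ε = 1 ∨ ε = -1 ∧ (RCLike.I : 𝕜) = 0) ∧ r ^ 2 = ε * z := by
  rcases eq_or_ne (RCLike.I : 𝕜) 0 with hI | hI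
  · have hz : z = ((RCLike.re z : ℝ) : 𝕜) := by
      conv_lhs => rw [← RCLike.re_add_im z, hI, mul_zero, add_zero]
    rcases le_total 0 (RCLike.re z) with h | h
    · refine ⟨1, ((Real.sqrt (RCLike.re z) : ℝ) : 𝕜), Or.inl rfl, ?_⟩
      rw [one_mul]
      conv_rhs => rw [hz]
      rw [← RCLike.ofReal_pow, Real.sq_sqrt h]
    · refine ⟨-1, ((Real.sqrt (-RCLike.re z) : ℝ) : 𝕜), Or.inr ⟨rfl, hI⟩, ?_⟩
      conv_rhs => rw [hz]
      rw [← RCLike.ofReal_pow, Real.sq_sqrt (neg_nonneg.2 h)]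
      simp
  · have hI1 : RCLike.im (RCLike.I : 𝕜) = 1 := RCLike.I_eq_zero_or_im_I_eq_one.resolve_left hI
    let e := RCLike.complexRingEquiv hI1
    obtain ⟨w, hw⟩ := IsAlgClosed.exists_pow_nat_eq (e z) two_pos
    exact ⟨1, e.symm w, Or.inl rfl, by rw [← map_pow, hw, e.symm_apply_apply, one_mul]⟩

/-- Up to a sign, which is only needed over `ℝ`, a non-vanishing smooth function has a smooth
square root locally. -/
theorem exists_local_sqrt {E : Type*} [NormedAddCommGroup E] [NormedSpace 𝕜 E] {h : E → 𝕜}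
    {V : Set E} (hV : IsOpen V) (hh : ContDiffOn 𝕜 ∞ h V) {p : E} (hp : p ∈ V) (hp0 : h p ≠ 0) :
    ∃ ε : 𝕜, (ε = 1 ∨ ε = -1 ∧ (RCLike.I : 𝕜) = 0) ∧ ∃ W : Set E, IsOpen W ∧ p ∈ W ∧ W ⊆ V ∧
      ∃ r : E → 𝕜, ContDiffOn 𝕜 ∞ r W ∧ ∀ u ∈ W, r u ≠ 0 ∧ r u ^ 2 = ε * h u := by
  obtain ⟨ε, r₀, hε, hr⟩ := exists_sq_eq_or_neg (h p)
  have hε0 : ε ≠ 0 := by rcases hε with rfl | ⟨rfl, -⟩ <;> simp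
  have hr0 : r₀ ≠ 0 := by
    rintro rfl
    rw [zero_pow two_ne_zero] at hr
    exact mul_ne_zero hε0 hp0 hr.symm
  have hd : fderiv 𝕜 (fun t : 𝕜 => t ^ 2) r₀ = (2 * r₀) • ContinuousLinearMap.id 𝕜 𝕜 := by
    ext
    simp
  obtain ⟨φ, hφ, -, -, hφs, hφe⟩ := exists_chart (𝕜 := 𝕜) (y := fun t : 𝕜 => t ^ 2) isOpen_univ
    (contDiff_id.pow 2).contDiffOn (Set.mem_univ r₀) (by
      rw [hd]
      intro x y hxy
      simpa [hr0] using hxy)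
  let k : E → 𝕜 := fun u => ε * h u
  have hk : ContDiffOn 𝕜 ∞ k V := contDiffOn_const.mul hh
  have hpk : k p ∈ φ.target := by
    have := φ.map_source hφ
    rw [hφe] at this
    simpa [k, ← hr] using this
  refine ⟨ε, hε, (V ∩ k ⁻¹' (φ.target ∩ {0}ᶜ)),
    hk.continuousOn.isOpen_inter_preimage hV (φ.open_target.inter isOpen_compl_singleton),
    ⟨hp, hpk, by simp [k, hε0, hp0]⟩, Set.inter_subset_left, fun u => φ.symm (k u),
    hφs.comp (hk.mono Set.inter_subset_left) fun u hu => hu.2.1, ?_⟩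
  intro u hu
  have h1 : φ.symm (k u) ^ 2 = k u := by
    have := φ.right_inv hu.2.1
    rwa [hφe] at this
  refine ⟨fun h0 => hu.2.2 ?_, h1⟩
  rw [show φ.symm (k u) = 0 from h0, zero_pow two_ne_zero] at h1
  exact h1.symm

/-- Rectification of a non-vanishing vector field in two variables. -/
theorem exists_flowBox {v : (Fin 2 → 𝕜) → Fin 2 → 𝕜} {V : Set (Fin 2 → 𝕜)} (hV : IsOpen V)
    (hv : ContDiffOn 𝕜 ∞ v V) {p : Fin 2 → 𝕜} (hp : p ∈ V) (hp0 : v p ≠ 0) :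
    ∃ φ : OpenPartialHomeomorph (Fin 2 → 𝕜) (Fin 2 → 𝕜), DNOperator.IsChangeOfVariables V p φ ∧
      ∀ u ∈ φ.source, fderiv 𝕜 φ u (v u) = Pi.single 0 1 := by
  obtain ⟨Φ, Ω, hΩ, hpΩ, hΦ, hΦ0, hΦd⟩ := exists_local_flow hV hv hp
  -- A direction transverse to `v p`: flowing the line through `p` along `e` parametrises a
  -- neighbourhood of `p`, and the inverse of this parametrisation rectifies `v`.
  obtain ⟨e, he⟩ : ∃ e : Fin 2 → 𝕜, ∀ a b : 𝕜, a • v p + b • e = 0 → a = 0 ∧ b = 0 := by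
    by_cases h0 : v p 0 = 0
    · have h1 : v p 1 ≠ 0 := fun h1 => hp0 (by ext i; fin_cases i <;> simp [h0, h1])
      refine ⟨![1, 0], fun a b hab => ?_⟩
      have e0 := congrFun hab 0
      have e1 := congrFun hab 1
      simp [h0] at e0
      simp [h1] at e1
      exact ⟨e1, e0⟩
    · refine ⟨![0, 1], fun a b hab => ?_⟩
      have e0 := congrFun hab 0
      have e1 := congrFun hab 1
      simp [h0] at e0
      simp [e0] at e1
      exact ⟨e0, e1⟩
  let c : (Fin 2 → 𝕜) → 𝕜 × (Fin 2 → 𝕜) := fun z => (z 0, p + z 1 • e)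
  have hc : ContDiff 𝕜 ∞ c := by fun_prop
  have hc0 : c 0 = (0, p) := by simp [c]
  let Ψ : (Fin 2 → 𝕜) → Fin 2 → 𝕜 := Φ ∘ c
  have hΨ0 : Ψ 0 = p := by
    simp only [Ψ, Function.comp_apply, hc0]
    exact hΦ0 p hpΩ
  have hct : Filter.Tendsto c (𝓝 0) (𝓝 ((0 : 𝕜), p)) := by
    rw [← hc0]
    exact hc.continuous.tendsto 0
  have hcΩ : ∀ᶠ z in 𝓝 (0 : Fin 2 → 𝕜), c z ∈ Ω := hct.eventually (hΩ.eventually_mem hpΩ)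
  have hdiff : ∀ᶠ z in 𝓝 (0 : Fin 2 → 𝕜), ContDiffAt 𝕜 ∞ Ψ z :=
    hcΩ.mono fun z hz => (hΦ.contDiffAt (hΩ.mem_nhds hz)).comp z hc.contDiffAt
  have hΨ : ContDiffAt 𝕜 ∞ Ψ 0 := hdiff.self_of_nhds
  have hline : ∀ z : Fin 2 → 𝕜, HasDerivAt (fun τ : 𝕜 => z + (τ - z 0) • Pi.single 0 1)
      (Pi.single 0 (1 : 𝕜) : Fin 2 → 𝕜) (z 0) := fun z => by
    simpa using (((hasDerivAt_id (z 0)).sub_const (z 0)).smul_const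
      (Pi.single 0 (1 : 𝕜) : Fin 2 → 𝕜)).const_add z
  have hder : ∀ᶠ z in 𝓝 (0 : Fin 2 → 𝕜), Ψ z ∈ V ∧ fderiv 𝕜 Ψ z (Pi.single 0 1) = v (Ψ z) := by
    filter_upwards [hdiff, hcΩ] with z hz hzΩ
    have hz' := hΦd _ hzΩ
    refine ⟨hz'.1, ?_⟩
    have h1 := HasFDerivAt.comp_hasDerivAt_of_eq (l := Ψ) (z 0)
      (hz.differentiableAt (by simp)).hasFDerivAt (hline z) (by simp)
    refine h1.unique ?_
    convert! hz'.2 using 1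
    ext τ : 1
    simp [Ψ, c]
  obtain ⟨N, hN, hNo, hN0⟩ := eventually_nhds_iff.1 (hdiff.and hder)
  have hinj : Function.Injective (fderiv 𝕜 Ψ 0) := by
    have h1 : fderiv 𝕜 Ψ 0 (Pi.single 0 1) = v p := by rw [(hN 0 hN0).2.2, hΨ0]
    have h2 : fderiv 𝕜 Ψ 0 (Pi.single 1 1) = e := by
      have hl : HasDerivAt (fun s : 𝕜 => s • (Pi.single 1 1 : Fin 2 → 𝕜)) (Pi.single 1 1) 0 := by
        simpa using (hasDerivAt_id (0 : 𝕜)).smul_const (Pi.single 1 1 : Fin 2 → 𝕜)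
      have h3 := HasFDerivAt.comp_hasDerivAt_of_eq (l := Ψ) 0
        (hΨ.differentiableAt (by simp)).hasFDerivAt hl (by simp)
      refine h3.unique ?_
      have h4 : HasDerivAt (fun s : 𝕜 => p + s • e) e 0 := by
        simpa using ((hasDerivAt_id (0 : 𝕜)).smul_const e).const_add p
      refine h4.congr_of_eventuallyEq ?_
      have ht : Filter.Tendsto (fun s : 𝕜 => p + s • e) (𝓝 0) (𝓝 p) := by
        simpa using h4.continuousAt.tendsto
      have ht' : Filter.Tendsto (fun s : 𝕜 => ((0 : 𝕜), p + s • e)) (𝓝 0) (𝓝 ((0 : 𝕜), p)) :=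
        tendsto_const_nhds.prodMk_nhds ht
      filter_upwards [ht'.eventually (hΩ.eventually_mem hpΩ)] with s hs
      simpa [Ψ, c] using hΦ0 _ hs
    rw [injective_iff_map_eq_zero]
    intro z hz
    have hz' : z = z 0 • (Pi.single 0 1 : Fin 2 → 𝕜) + z 1 • (Pi.single 1 1 : Fin 2 → 𝕜) := by
      ext i
      fin_cases i <;> simp
    rw [hz', map_add, map_smul, map_smul, h1, h2] at hz
    obtain ⟨h3, h4⟩ := he _ _ hz
    rw [hz', h3, h4]
    simp
  obtain ⟨φ, hφ0, hφs, hφ, hφi, hφe⟩ := exists_chart hNo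
    (fun z hz => (hN z hz).1.contDiffWithinAt) hN0 hinj
  refine ⟨φ.symm, ⟨?_, ?_, hφi, by simpa using hφ⟩, ?_⟩
  · have := φ.map_source hφ0
    rwa [hφe, hΨ0] at this
  · intro u hu
    have h1 := φ.map_target hu
    have h2 := (hN _ (hφs h1)).2.1
    rwa [← hφe, φ.right_inv hu] at h2
  · intro u hu
    have h1 := φ.map_target hu
    have h2 := (hN _ (hφs h1)).2.2
    rw [← hφe, φ.right_inv hu] at h2
    have h3 : HasFDerivAt φ (fderiv 𝕜 φ (φ.symm u)) (φ.symm u) := by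
      rw [hφe]
      exact ((hN _ (hφs h1)).1.differentiableAt (by simp)).hasFDerivAt
    have h4 : HasFDerivAt φ.symm (fderiv 𝕜 φ.symm u) (φ (φ.symm u)) := by
      rw [φ.right_inv hu]
      exact ((hφi.contDiffAt (φ.open_target.mem_nhds hu)).differentiableAt (by simp)).hasFDerivAt
    have h5 := h4.comp _ h3
    have h6 : HasFDerivAt (φ.symm ∘ φ) (ContinuousLinearMap.id 𝕜 (Fin 2 → 𝕜)) (φ.symm u) :=
      (hasFDerivAt_id _).congr_of_eventuallyEq (φ.eventually_left_inverse h1)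
    have h7 := DFunLike.congr_fun (h5.unique h6) (Pi.single 0 1)
    rw [ContinuousLinearMap.comp_apply, h2] at h7
    exact h7

end Charts

/-! ### Partial derivatives in the dependent variables. -/

section PartialDerivatives

variable {𝕜 : Type*} [RCLike 𝕜] {n : ℕ}

/-- The partial derivative `∂f/∂u^k` of a function of the dependent variables. -/
noncomputable def pd (k : Fin n) (f : (Fin n → 𝕜) → 𝕜) (u : Fin n → 𝕜) : 𝕜 :=
  fderiv 𝕜 f u (Pi.single k 1)

theorem fderiv_eq_sum_pd (f : (Fin n → 𝕜) → 𝕜) (u e : Fin n → 𝕜) :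
    fderiv 𝕜 f u e = ∑ k, e k * pd k f u := by
  conv_lhs => rw [pi_eq_sum_univ' e, map_sum]
  exact Finset.sum_congr rfl fun k _ => by simp [pd]

theorem hasDerivAt_comp_update {f : (Fin n → 𝕜) → 𝕜} {u : Fin n → 𝕜} (hf : DifferentiableAt 𝕜 f u)
    (k : Fin n) : HasDerivAt (fun t => f (Function.update u k t)) (pd k f u) (u k) := by
  have h1 := hasDerivAt_update u k (u k)
  exact HasFDerivAt.comp_hasDerivAt_of_eq (l := f) (u k) hf.hasFDerivAt h1 (by simp)

end PartialDerivatives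

/-! ### A necessary condition for being a total derivative. -/

namespace JetFunction

variable {𝕜 : Type*} [RCLike 𝕜] {n : ℕ}

/-- The second derivatives of the coefficients of a total derivative of order one agree. -/
theorem IntegralEqZero.deriv_eq_fderiv {U : Set (Fin n → 𝕜)} (hU : IsOpen U)
    {f : JetFunction 𝕜 n} (hf : IntegralEqZero U f) (e : Fin n → 𝕜)
    (hlow : ∀ j x u (τ : 𝕜), u ∈ U →
      f x (Pi.single 0 u + Pi.single (j + 2) (τ • e)) = f x (Pi.single 0 u))
    {A B : 𝕜 → (Fin n → 𝕜) → 𝕜} (hA : ∀ x, ∀ u ∈ U, f x (Pi.single 0 u) = A x u)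
    (hB : ∀ x, ∀ u ∈ U,
      HasDerivAt (fun τ : 𝕜 => f x (Pi.single 0 u + Pi.single 1 (τ • e))) (B x u) 0)
    (x : 𝕜) {u : Fin n → 𝕜} (hu : u ∈ U) :
    deriv (fun x => B x u) x = fderiv 𝕜 (A x) u e := by
  obtain ⟨h, ⟨N, F, hF, hhF⟩, hfh⟩ := hf
  let D : Set (𝕜 × (Fin (N + 1) → Fin n → 𝕜)) := {z | z.2 0 ∈ U}
  have hD : IsOpen D := hU.preimage (by fun_prop)
  have hdiff : ∀ z ∈ D, HasFDerivAt F (fderiv 𝕜 F z) z := fun z hz =>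
    ((hF.contDiffAt (hD.mem_nhds hz)).differentiableAt (by simp)).hasFDerivAt
  have hdiff2 : ∀ z ∈ D, HasFDerivAt (fderiv 𝕜 F) (fderiv 𝕜 (fderiv 𝕜 F) z) z := fun z hz =>
    (((hF.contDiffAt (hD.mem_nhds hz)).fderiv_right (m := ∞)
      (by simp)).differentiableAt (by simp)).hasFDerivAt
  have hsymm : ∀ z ∈ D, ∀ a b, fderiv 𝕜 (fderiv 𝕜 F) z a b = fderiv 𝕜 (fderiv 𝕜 F) z b a :=
    fun z hz a b => (hF.contDiffAt (hD.mem_nhds hz)).isSymmSndFDerivAt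
      (by rw [minSmoothness_of_isRCLikeNormedField]; exact ENat.LEInfty.out) a b
  let tr : (ℕ → Fin n → 𝕜) → Fin (N + 1) → Fin n → 𝕜 := fun w k => w k
  have htot : ∀ x w, w 0 ∈ U →
      f x w = fderiv 𝕜 F (x, tr w) (1, tr fun k => w (k + 1)) := by
    intro x w hw
    rw [hfh x w hw]
    have h1 : HasDerivAt (fun t : 𝕜 => (x, tr w) + t • ((1 : 𝕜), tr fun k => w (k + 1)))
        ((1 : 𝕜), tr fun k => w (k + 1)) 0 := by
      simpa using ((hasDerivAt_id (0 : 𝕜)).smul_const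
        ((1 : 𝕜), tr fun k => w (k + 1))).const_add (x, tr w)
    have h2 := HasFDerivAt.comp_hasDerivAt_of_eq (l := F) 0 (hdiff (x, tr w) hw) h1 (by simp)
    refine Eq.trans ?_ h2.deriv
    refine congrArg (fun q => deriv q 0) (funext fun t => ?_)
    simp only [hhF, Function.comp_apply]
    congr 1
    ext <;> simp [tr]
  let z₀ : 𝕜 → (Fin n → 𝕜) → 𝕜 × (Fin (N + 1) → Fin n → 𝕜) := fun x u => (x, tr (Pi.single 0 u))
  have hz₀ : ∀ x, ∀ u ∈ U, z₀ x u ∈ D := fun x u hu => by simpa [z₀, D, tr] using hu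
  let δ : ℕ → 𝕜 × (Fin (N + 1) → Fin n → 𝕜) := fun j => (0, tr (Pi.single j e))
  have hjet : ∀ j x u (τ : 𝕜), u ∈ U → f x (Pi.single 0 u + Pi.single (j + 1) (τ • e))
      = fderiv 𝕜 F (z₀ x u + τ • δ (j + 1)) ((1, 0) + τ • δ j) := by
    intro j x u τ hu
    rw [htot x _ (by simpa using hu)]
    congr 1
    · congr 1
      ext1
      · simp [z₀, δ]
      · ext k i
        simp only [z₀, δ, tr, Pi.single_apply, Pi.add_apply, Prod.snd_add, Prod.smul_snd,
          Pi.smul_apply]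
        split_ifs <;> simp
    · ext1
      · simp [δ]
      · ext k i
        by_cases hk : (k : ℕ) = j <;> simp [δ, tr, hk, Pi.single_apply]
  have hbase : ∀ x, ∀ u ∈ U, f x (Pi.single 0 u) = fderiv 𝕜 F (z₀ x u) (1, 0) := by
    intro x u hu
    have := hjet 0 x u 0 hu
    simpa using this
  -- This is the commutation `∂(D h)/∂u_{j+1} = D(∂h/∂u_{j+1}) + ∂h/∂u_j` along `e`, at jets where
  -- all derivatives of `u` vanish, so that `D` reduces to `∂/∂x`.
  have hjd : ∀ j x, ∀ u ∈ U, HasDerivAt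
      (fun τ : 𝕜 => f x (Pi.single 0 u + Pi.single (j + 1) (τ • e)))
      (fderiv 𝕜 (fderiv 𝕜 F) (z₀ x u) (δ (j + 1)) (1, 0) + fderiv 𝕜 F (z₀ x u) (δ j)) 0 := by
    intro j x u hu
    simp only [hjet j x u _ hu]
    have h1 : HasDerivAt (fun τ : 𝕜 => z₀ x u + τ • δ (j + 1)) (δ (j + 1)) 0 := by
      simpa using ((hasDerivAt_id (0 : 𝕜)).smul_const (δ (j + 1))).const_add (z₀ x u)
    have h2 : HasDerivAt (fun τ : 𝕜 => ((1, 0) : 𝕜 × (Fin (N + 1) → Fin n → 𝕜)) + τ • δ j)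
        (δ j) 0 := by
      simpa using ((hasDerivAt_id (0 : 𝕜)).smul_const (δ j)).const_add
        ((1, 0) : 𝕜 × (Fin (N + 1) → Fin n → 𝕜))
    have h3 := HasFDerivAt.comp_hasDerivAt_of_eq (l := fderiv 𝕜 F) 0
      (hdiff2 _ (hz₀ x u hu)) h1 (by simp)
    simpa using h3.clm_apply h2
  have hGx : ∀ j x, ∀ u ∈ U, HasDerivAt (fun x => fderiv 𝕜 F (z₀ x u) (δ j))
      (fderiv 𝕜 (fderiv 𝕜 F) (z₀ x u) (δ j) (1, 0)) x := by
    intro j x u hu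
    have h1 : HasDerivAt (fun x => z₀ x u) (1, 0) x :=
      (hasDerivAt_id x).prodMk (hasDerivAt_const x _)
    have h3 := HasFDerivAt.comp_hasDerivAt (l := fderiv 𝕜 F) x (hdiff2 _ (hz₀ x u hu)) h1
    rw [hsymm _ (hz₀ x u hu)]
    simpa using h3.clm_apply (hasDerivAt_const x (δ j))
  -- Descending induction on the order: `h` does not depend on derivatives above `N`, and `hlow`
  -- passes vanishing from order `m + 2` to order `m + 1`. It stops at order one, since nothing is
  -- assumed about `f` in the direction `u_x`.
  have hG0 : ∀ j, ∀ x, ∀ u ∈ U, fderiv 𝕜 F (z₀ x u) (δ (N + 1 - j + 1)) = 0 := by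
    intro j
    induction j with
    | zero =>
      intro x u _
      have : δ (N + 1 - 0 + 1) = 0 := by
        refine Prod.ext rfl (funext fun k => ?_)
        have hk : (k : ℕ) ≠ N + 1 - 0 + 1 := by omega
        simp only [δ, tr, Pi.single_apply, if_neg hk]
        rfl
      rw [this, map_zero]
    | succ j ih =>
      intro x u hu
      -- Here truncated subtraction keeps the order at one, and there is nothing more to prove.
      by_cases hj : N + 1 ≤ j
      · have := ih x u hu
        rwa [show N + 1 - j = N + 1 - (j + 1) by omega] at this
      · obtain ⟨m, hm⟩ : ∃ m, N + 1 - (j + 1) = m := ⟨_, rfl⟩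
        have hm' : N + 1 - j = m + 1 := by omega
        rw [hm'] at ih
        rw [hm]
        have h1 := hjd (m + 1) x u hu
        have h2 : HasDerivAt (fun τ : 𝕜 => f x (Pi.single 0 u + Pi.single (m + 1 + 1) (τ • e)))
            0 0 := by
          simp only [hlow m x u _ hu]
          exact hasDerivAt_const _ _
        have h3 : fderiv 𝕜 (fderiv 𝕜 F) (z₀ x u) (δ (m + 1 + 1)) (1, 0) = 0 := by
          refine (hGx _ x u hu).unique ?_
          simp only [ih _ u hu]
          exact hasDerivAt_const _ _
        have h4 := h1.unique h2
        rwa [h3, zero_add] at h4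
  have hG1 : ∀ x, ∀ u ∈ U, fderiv 𝕜 F (z₀ x u) (δ 1) = 0 := fun x u hu => by
    simpa using hG0 (N + 1) x u hu
  have hB0 : ∀ x, B x u = fderiv 𝕜 F (z₀ x u) (δ 0) := by
    intro x
    have h3 : fderiv 𝕜 (fderiv 𝕜 F) (z₀ x u) (δ 1) (1, 0) = 0 := by
      refine (hGx _ x u hu).unique ?_
      simp only [hG1 _ u hu]
      exact hasDerivAt_const _ _
    have h4 := (hB x u hu).unique (hjd 0 x u hu)
    rwa [zero_add, h3, zero_add] at h4
  simp only [hB0]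
  rw [(hGx 0 x u hu).deriv]
  have hz1 : HasFDerivAt (z₀ x) (fderiv 𝕜 (z₀ x) u) u := by
    refine DifferentiableAt.hasFDerivAt ?_
    refine DifferentiableAt.prodMk (differentiableAt_const _) ?_
    refine differentiableAt_pi.2 fun k => ?_
    by_cases hk : (k : ℕ) = 0
    · simp [tr, hk]
    · simp [tr, hk]
  have hze : fderiv 𝕜 (z₀ x) u e = δ 0 := by
    have h1 : HasDerivAt (fun t : 𝕜 => u + t • e) e 0 := by
      simpa using ((hasDerivAt_id (0 : 𝕜)).smul_const e).const_add u
    have h2 := HasFDerivAt.comp_hasDerivAt_of_eq (l := z₀ x) 0 hz1 h1 (by simp)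
    refine h2.unique ?_
    have h3 : HasDerivAt (fun t : 𝕜 => z₀ x u + t • δ 0) (δ 0) 0 := by
      simpa using ((hasDerivAt_id (0 : 𝕜)).smul_const (δ 0)).const_add (z₀ x u)
    convert! h3 using 1
    ext t : 1
    refine Prod.ext (by simp [z₀, δ]) (funext fun k => ?_)
    simp only [z₀, δ, tr, Function.comp_apply, Pi.single_apply, Prod.snd_add, Prod.smul_snd, Pi.add_apply,
      Pi.smul_apply]
    split_ifs <;> simp
  have hAe : HasFDerivAt (A x)
      ((ContinuousLinearMap.apply 𝕜 𝕜 ((1, 0) : 𝕜 × (Fin (N + 1) → Fin n → 𝕜))).comp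
        ((fderiv 𝕜 (fderiv 𝕜 F) (z₀ x u)).comp (fderiv 𝕜 (z₀ x) u))) u := by
    have h1 := (hdiff2 _ (hz₀ x u hu)).comp u hz1
    have h2 := ((ContinuousLinearMap.apply 𝕜 𝕜
      ((1, 0) : 𝕜 × (Fin (N + 1) → Fin n → 𝕜))).hasFDerivAt).comp u h1
    refine h2.congr_of_eventuallyEq ?_
    filter_upwards [hU.mem_nhds hu] with u' hu'
    rw [← hA x u' hu', hbase x u' hu']
    rfl
  rw [hAe.fderiv]
  simp [hze]

end JetFunction

/-! ### Variational derivatives of the test densities. -/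

namespace JetFunction

variable {𝕜 : Type*} [RCLike 𝕜] {n : ℕ}

theorem totalDeriv_zero : totalDeriv (0 : JetFunction 𝕜 n) = 0 := by
  funext x w
  simp [totalDeriv]

theorem iterate_totalDeriv_zero (k : ℕ) : totalDeriv^[k] (0 : JetFunction 𝕜 n) = 0 :=
  Function.iterate_fixed totalDeriv_zero k

theorem isDensity_mul {p : 𝕜 → 𝕜} (hp : ContDiff 𝕜 ∞ p) {ψ : (Fin n → 𝕜) → 𝕜}
    (hψ : ContDiff 𝕜 ∞ ψ) (U : Set (Fin n → 𝕜)) :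
    IsDensity U (fun x w => p x * ψ (w 0)) := by
  refine ⟨0, fun z => p z.1 * ψ (z.2 0), ContDiff.contDiffOn ?_, fun x w => rfl⟩
  exact (hp.comp contDiff_fst).mul (hψ.comp (by fun_prop))

theorem varDeriv_mul {p : 𝕜 → 𝕜} {ψ : (Fin n → 𝕜) → 𝕜} (hψ : Differentiable 𝕜 ψ) (s : Fin n) :
    varDeriv (fun x w => p x * ψ (w 0) : JetFunction 𝕜 n) s
      = fun x w => p x * pd s ψ (w 0) := by
  funext x w
  have h : ∀ k ≠ 0, partialDeriv s k (fun x w => p x * ψ (w 0) : JetFunction 𝕜 n) = 0 := by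
    intro k hk
    funext x w
    simp [partialDeriv, Function.update_of_ne hk.symm]
  rw [varDeriv, finsum_eq_single _ 0]
  · simp only [pow_zero, one_mul, Function.iterate_zero, id, partialDeriv, Function.update_self]
    exact ((hasDerivAt_comp_update (hψ (w 0)) s).const_mul (p x)).deriv
  · intro k hk
    rw [h k hk, iterate_totalDeriv_zero]
    simp

theorem totalDeriv_mul {p : 𝕜 → 𝕜} (hp : Differentiable 𝕜 p) {ψ : (Fin n → 𝕜) → 𝕜}
    (x : 𝕜) (w : ℕ → Fin n → 𝕜) (hψ : DifferentiableAt 𝕜 ψ (w 0)) :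
    totalDeriv (fun x w => p x * ψ (w 0) : JetFunction 𝕜 n) x w
      = deriv p x * ψ (w 0) + p x * ∑ k, w 1 k * pd k ψ (w 0) := by
  have h1 : HasDerivAt (fun t : 𝕜 => p (x + t)) (deriv p x) 0 := by
    have := (hp x).hasDerivAt
    rw [← add_zero x] at this
    simpa using HasDerivAt.comp_const_add x 0 this
  have h2 : HasDerivAt (fun t : 𝕜 => w 0 + t • w 1) (w 1) 0 := by
    simpa using ((hasDerivAt_id (0 : 𝕜)).smul_const (w 1)).const_add (w 0)
  have h3 := HasFDerivAt.comp_hasDerivAt_of_eq (l := ψ) 0 hψ.hasFDerivAt h2 (by simp)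
  have h4 := (h1.mul h3).deriv
  rw [fderiv_eq_sum_pd] at h4
  simp only [add_zero, zero_smul, Function.comp_apply] at h4
  exact h4

/-- A density which is affine in `u_x`. -/
def affineDensity (p q : 𝕜 → 𝕜) (β : Fin n → (Fin n → 𝕜) → 𝕜) (α : (Fin n → 𝕜) → 𝕜) :
    JetFunction 𝕜 n :=
  fun x w => p x * ∑ k, β k (w 0) * w 1 k + q x * α (w 0)

/-- Brackets of the test functionals have densities of this kind. The derivatives of `β` produced by
the order-one term combine with those of order zero into a curl, so no second derivatives of `u`
appear. -/
theorem varDeriv_affineDensity {p q : 𝕜 → 𝕜} (hp : Differentiable 𝕜 p)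
    {β : Fin n → (Fin n → 𝕜) → 𝕜} {α : (Fin n → 𝕜) → 𝕜} {x : 𝕜} {w : ℕ → Fin n → 𝕜}
    (hβ : ∀ k, DifferentiableAt 𝕜 (β k) (w 0)) (hα : DifferentiableAt 𝕜 α (w 0)) (s : Fin n) :
    varDeriv (affineDensity p q β α) s x w
      = p x * ∑ k, (pd s (β k) (w 0) - pd k (β s) (w 0)) * w 1 k
        + (q x * pd s α (w 0) - deriv p x * β s (w 0)) := by
  have h0 : partialDeriv s 0 (affineDensity p q β α) x w
      = p x * ∑ k, pd s (β k) (w 0) * w 1 k + q x * pd s α (w 0) := by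
    simp only [partialDeriv, affineDensity, Function.update_self, ne_eq, one_ne_zero,
      not_false_eq_true, Function.update_of_ne]
    refine HasDerivAt.deriv ?_
    exact ((HasDerivAt.fun_sum fun k _ =>
      (hasDerivAt_comp_update (hβ k) s).mul_const (w 1 k)).const_mul (p x)).add
      ((hasDerivAt_comp_update hα s).const_mul (q x))
  have h1 : partialDeriv s 1 (affineDensity p q β α) = fun x w => p x * β s (w 0) := by
    funext x w
    simp only [partialDeriv, affineDensity, Function.update_self, ne_eq, zero_ne_one,
      not_false_eq_true, Function.update_of_ne]
    refine HasDerivAt.deriv ?_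
    have h2 : HasDerivAt (fun t => ∑ k, β k (w 0) * Function.update (w 1) s t k)
        (∑ k, β k (w 0) * (Pi.single s 1 : Fin n → 𝕜) k) (w 1 s) :=
      HasDerivAt.fun_sum fun k _ =>
        ((hasDerivAt_pi.1 (hasDerivAt_update (w 1) s (w 1 s))) k).const_mul (β k (w 0))
    have h3 := (h2.const_mul (p x)).add_const (q x * α (w 0))
    simpa [Pi.single_apply] using h3
  have h2 : ∀ k, partialDeriv s (k + 2) (affineDensity p q β α) = 0 := by
    intro k
    funext x w
    simp [partialDeriv, affineDensity]
  rw [varDeriv, finsum_eq_sum_of_support_subset (s := Finset.range 2)]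
  · rw [Finset.sum_range_succ, Finset.sum_range_one]
    simp only [pow_zero, one_mul, Function.iterate_zero, id, pow_one, Function.iterate_one, h0, h1]
    rw [totalDeriv_mul hp x w (hβ s)]
    simp only [sub_mul, Finset.sum_sub_distrib, mul_comm (w 1 _)]
    ring
  · intro k hk
    by_contra hk'
    obtain ⟨m, rfl⟩ : ∃ m, k = m + 2 := ⟨k - 2, by
      simp only [Finset.coe_range, Set.mem_Iio, not_lt] at hk'
      omega⟩
    refine hk ?_
    simp only
    rw [h2, iterate_totalDeriv_zero]
    simp

end JetFunction

/-! ### The operator applied to test functionals. -/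

namespace DNOperator

open JetFunction

variable {𝕜 : Type*} [RCLike 𝕜] {n : ℕ}

theorem apply_single (P : DNOperator 𝕜 n) (j : Fin n) (ζ : JetFunction 𝕜 n) (i : Fin n) (x : 𝕜)
    (w : ℕ → Fin n → 𝕜) :
    P.apply (Pi.single j ζ) i x w
      = P.g (w 0) i j * totalDeriv ζ x w + ∑ k, P.b (w 0) i j k * w 1 k * ζ x w := by
  rw [apply, Finset.sum_eq_single j, Finset.sum_eq_single j]
  · simp
  · intro j' _ hj'
    simp [Pi.single_eq_of_ne hj']
  · simp
  · intro j' _ hj'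
    simp [Pi.single_eq_of_ne hj', totalDeriv_zero]
  · simp

theorem bracket_of_varDeriv_eq_single (P : DNOperator 𝕜 n) {f h : JetFunction 𝕜 n} {i : Fin n}
    {ξ : JetFunction 𝕜 n} (hf : varDeriv f = Pi.single i ξ) :
    P.bracket f h = fun x w => ξ x w * P.apply (varDeriv h) i x w := by
  funext x w
  rw [bracket, hf, Finset.sum_eq_single i]
  · simp
  · intro i' _ hi'
    simp [Pi.single_eq_of_ne hi']
  · simp

/-- The density `(u^i - c)² / 2`. -/
def quadraticDensity (i : Fin n) (c : 𝕜) : JetFunction 𝕜 n := fun _ w => (w 0 i - c) ^ 2 / 2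

/-- The density `p(x) u^j`. -/
def linearDensity (j : Fin n) (p : 𝕜 → 𝕜) : JetFunction 𝕜 n := fun x w => p x * w 0 j

theorem isDensity_quadraticDensity (i : Fin n) (c : 𝕜) (U : Set (Fin n → 𝕜)) :
    IsDensity U (quadraticDensity i c) := by
  have := isDensity_mul (p := fun _ : 𝕜 => (1 : 𝕜)) contDiff_const
    (ψ := fun u : Fin n → 𝕜 => (u i - c) ^ 2 / 2) (by fun_prop) U
  simp only [one_mul] at this
  exact this

theorem isDensity_linearDensity (j : Fin n) {p : 𝕜 → 𝕜} (hp : ContDiff 𝕜 ∞ p)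
    (U : Set (Fin n → 𝕜)) : IsDensity U (linearDensity j p) :=
  isDensity_mul hp (ψ := fun u : Fin n → 𝕜 => u j) (by fun_prop) U

theorem pd_coord (s j : Fin n) (u : Fin n → 𝕜) :
    pd s (fun u : Fin n → 𝕜 => u j) u = if s = j then 1 else 0 := by
  rw [pd, (hasFDerivAt_apply j u).fderiv]
  simp [Pi.single_apply, eq_comm]

theorem varDeriv_quadraticDensity (i : Fin n) (c : 𝕜) :
    varDeriv (quadraticDensity i c) = Pi.single i fun _ w => w 0 i - c := by
  funext s
  have h := varDeriv_mul (p := fun _ : 𝕜 => (1 : 𝕜))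
    (ψ := fun u : Fin n → 𝕜 => (u i - c) ^ 2 / 2) (by fun_prop) s
  simp only [one_mul] at h
  refine h.trans ?_
  funext x w
  have h2 : HasFDerivAt (fun u : Fin n → 𝕜 => (u i - c) ^ 2 / 2)
      ((w 0 i - c) • ContinuousLinearMap.proj (R := 𝕜) (φ := fun _ : Fin n => 𝕜) i) (w 0) := by
    have h3 := ((((hasFDerivAt_apply (𝕜 := 𝕜) i (w 0)).sub_const c).pow 2).mul_const (2⁻¹ : 𝕜))
    refine (h3.congr_fderiv ?_).congr_of_eventuallyEq (.of_forall fun u => by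
      simp [div_eq_mul_inv])
    ext v
    simp
    ring
  rw [pd, h2.fderiv]
  by_cases hs : s = i
  · subst hs
    simp
  · simp [hs]

theorem varDeriv_linearDensity (j : Fin n) (p : 𝕜 → 𝕜) :
    varDeriv (linearDensity j p) = Pi.single j fun x _ => p x := by
  funext s
  refine (varDeriv_mul (p := p) (ψ := fun u : Fin n → 𝕜 => u j) (by fun_prop) s).trans ?_
  funext x w
  rw [pd_coord]
  by_cases hs : s = j
  · subst hs
    simp
  · simp [hs]

theorem apply_varDeriv_quadraticDensity (P : DNOperator 𝕜 n) (i s : Fin n) (c : 𝕜) (x : 𝕜)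
    (w : ℕ → Fin n → 𝕜) :
    P.apply (varDeriv (quadraticDensity i c)) s x w
      = P.g (w 0) s i * w 1 i + (w 0 i - c) * ∑ k, P.b (w 0) s i k * w 1 k := by
  rw [varDeriv_quadraticDensity, apply_single, Finset.mul_sum]
  have h : totalDeriv (fun _ w => w 0 i - c : JetFunction 𝕜 n) x w = w 1 i := by
    simp only [totalDeriv]
    have : HasDerivAt (fun t : 𝕜 => (w 0 + t • w (0 + 1)) i - c) (w 1 i) 0 := by
      simpa using (((hasDerivAt_id (0 : 𝕜)).mul_const (w 1 i)).const_add (w 0 i)).sub_const c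
    exact this.deriv
  rw [h]
  exact congrArg₂ _ rfl (Finset.sum_congr rfl fun k _ => by ring)

theorem apply_varDeriv_linearDensity (P : DNOperator 𝕜 n) (j s : Fin n) (p : 𝕜 → 𝕜) (x : 𝕜)
    (w : ℕ → Fin n → 𝕜) :
    P.apply (varDeriv (linearDensity j p)) s x w
      = P.g (w 0) s j * deriv p x + p x * ∑ k, P.b (w 0) s j k * w 1 k := by
  rw [varDeriv_linearDensity, apply_single, Finset.mul_sum]
  have h : totalDeriv (fun x _ => p x : JetFunction 𝕜 n) x w = deriv p x := by
    simp only [totalDeriv]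
    rw [deriv_comp_const_add, add_zero]
  rw [h]
  exact congrArg₂ _ rfl (Finset.sum_congr rfl fun k _ => by ring)

end DNOperator

/-! ### Coefficient identities from skew-symmetry and the Jacobi identity. -/

namespace DNOperator

open JetFunction

variable {𝕜 : Type*} [RCLike 𝕜] {n : ℕ}

theorem contDiff_sq_id : ContDiff 𝕜 ∞ fun x : 𝕜 => x ^ 2 := contDiff_id.pow 2

theorem deriv_sq_id (x : 𝕜) : deriv (fun x : 𝕜 => x ^ 2) x = 2 * x := by simp

theorem SmoothOn.differentiableAt_g {P : DNOperator 𝕜 n} {U : Set (Fin n → 𝕜)}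
    (hP : P.SmoothOn U) (hU : IsOpen U) {u : Fin n → 𝕜} (hu : u ∈ U) (i j : Fin n) :
    DifferentiableAt 𝕜 (fun u => P.g u i j) u :=
  ((hP.1 i j).contDiffAt (hU.mem_nhds hu)).differentiableAt (by simp)

theorem SmoothOn.differentiableAt_b {P : DNOperator 𝕜 n} {U : Set (Fin n → 𝕜)}
    (hP : P.SmoothOn U) (hU : IsOpen U) {u : Fin n → 𝕜} (hu : u ∈ U) (i j k : Fin n) :
    DifferentiableAt 𝕜 (fun u => P.b u i j k) u :=
  ((hP.2 i j k).contDiffAt (hU.mem_nhds hu)).differentiableAt (by simp)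

theorem pd_mul {f h : (Fin n → 𝕜) → 𝕜} {u : Fin n → 𝕜} (hf : DifferentiableAt 𝕜 f u)
    (hh : DifferentiableAt 𝕜 h u) (k : Fin n) :
    pd k (fun u => f u * h u) u = f u * pd k h u + h u * pd k f u := by
  rw [pd, fderiv_fun_mul hf hh]
  simp [pd]

theorem pd_add {f h : (Fin n → 𝕜) → 𝕜} {u : Fin n → 𝕜} (hf : DifferentiableAt 𝕜 f u)
    (hh : DifferentiableAt 𝕜 h u) (k : Fin n) :
    pd k (fun u => f u + h u) u = pd k f u + pd k h u := by
  rw [pd, fderiv_fun_add hf hh]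
  simp [pd]

theorem pd_coord_sub (s j : Fin n) (c : 𝕜) (u : Fin n → 𝕜) :
    pd s (fun u : Fin n → 𝕜 => u j - c) u = if s = j then 1 else 0 := by
  rw [← pd_coord s j u, pd, pd, fderiv_sub_const]

/-- The conditions coming from the skew-symmetry of the bracket. -/
theorem IsHamiltonian.skew {P : DNOperator 𝕜 n} {U : Set (Fin n → 𝕜)} (hU : IsOpen U)
    (hs : P.SmoothOn U) (hP : P.IsHamiltonian U) {u : Fin n → 𝕜} (hu : u ∈ U) (i j k : Fin n)
    (c : 𝕜) :
    (u i - c) * (pd k (fun u => P.g u i j) u - P.b u i j k - P.b u j i k)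
      + (if k = i then P.g u i j - P.g u j i else 0) = 0 := by
  -- The weight `p(x) = x` makes the term with `p'` survive at `u_x = 0`; comparing it with the
  -- `x`-derivative of the `u_x`-coefficient gives the identity.
  have hz := hP.1 _ _ (isDensity_quadraticDensity i c U) (isDensity_linearDensity j contDiff_id U)
  have hT : (fun x w => P.bracket (quadraticDensity i c) (linearDensity j id) x w
      + P.bracket (linearDensity j id) (quadraticDensity i c) x w)
      = fun x w => (w 0 i - c) * (P.g (w 0) i j + x * ∑ k, P.b (w 0) i j k * w 1 k)
        + x * (P.g (w 0) j i * w 1 i + (w 0 i - c) * ∑ k, P.b (w 0) j i k * w 1 k) := by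
    funext x w
    rw [bracket_of_varDeriv_eq_single P (varDeriv_quadraticDensity i c),
      bracket_of_varDeriv_eq_single P (varDeriv_linearDensity j id)]
    simp only
    rw [apply_varDeriv_linearDensity, apply_varDeriv_quadraticDensity]
    simp
  rw [hT] at hz
  have key := hz.deriv_eq_fderiv hU (Pi.single k 1) (fun l x u τ _ => by simp)
    (A := fun _ u => (u i - c) * P.g u i j)
    (B := fun x u => x * ((u i - c) * P.b u i j k
      + (P.g u j i * (if k = i then 1 else 0) + (u i - c) * P.b u j i k)))
    (fun x u _ => by simp)
    (fun x u _ => by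
      simp only [Pi.add_apply, Pi.single_eq_same, ne_eq, one_ne_zero, not_false_eq_true,
        Pi.single_eq_of_ne, zero_ne_one, add_zero, Pi.smul_apply, Pi.single_apply,
        smul_eq_mul]
      have h0 : HasDerivAt (fun τ : 𝕜 => τ) 1 0 := hasDerivAt_id 0
      have h := (((h0.const_mul (P.b u i j k)).const_mul x).const_add (P.g u i j)).const_mul
        (u i - c) |>.add
        ((((h0.const_mul (P.g u j i * (if k = i then 1 else 0)))).add
          ((h0.const_mul (P.b u j i k)).const_mul (u i - c))).const_mul x)
      convert! h using 1
      · ext τ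
        simp [eq_comm]
      · simp only [mul_one, mul_ite, mul_zero]
        ring) 0 hu
  rw [deriv_mul_const_field, deriv_id''] at key
  have hA : fderiv 𝕜 (fun u => (u i - c) * P.g u i j) u (Pi.single k 1)
      = (u i - c) * pd k (fun u => P.g u i j) u + P.g u i j * if k = i then 1 else 0 := by
    rw [← pd_coord_sub k i c u]
    exact pd_mul (by fun_prop) (hs.differentiableAt_g hU hu i j) k
  rw [hA] at key
  split_ifs at key ⊢ <;> linear_combination -key

/-- The condition coming from the Jacobi identity. -/
theorem IsHamiltonian.jacobi {P : DNOperator 𝕜 n} {U : Set (Fin n → 𝕜)} (hU : IsOpen U)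
    (hs : P.SmoothOn U) (hP : P.IsHamiltonian U) {u : Fin n → 𝕜} (hu : u ∈ U) (i j t k : Fin n)
    (c : 𝕜) :
    ∑ s, ((pd s (fun u => (u i - c) * P.b u i j k) u - pd k (fun u => (u i - c) * P.b u i j s) u)
        * P.g u s t
      + (pd s (fun u => P.g u j t) u - P.b u j t s)
        * (P.g u s i * (if k = i then 1 else 0) + (u i - c) * P.b u s i k)
      - (P.g u t i * (if s = i then 1 else 0) + (u i - c) * P.b u t i s) * P.b u s j k) = 0 := by
  let f := quadraticDensity i c
  let h := linearDensity j fun _ : 𝕜 => (1 : 𝕜)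
  -- With weight `x²`, the part of the Jacobi expression linear in `u_x` carries exactly one factor
  -- `p' = 2x`, while terms with `x²` are quadratic in `u_x`. One `x`-derivative therefore isolates
  -- the required coefficient, and the part free of `u_x` is zero.
  let q := linearDensity t fun x : 𝕜 => x ^ 2
  have hz := hP.2 f h q (isDensity_quadraticDensity i c U) (isDensity_linearDensity j contDiff_const U)
    (isDensity_linearDensity t contDiff_sq_id U)
  let β₁ : Fin n → (Fin n → 𝕜) → 𝕜 := fun k u => (u i - c) * P.b u i j k
  let β₂ : Fin n → (Fin n → 𝕜) → 𝕜 := fun k u => P.b u j t k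
  let β₃ : Fin n → (Fin n → 𝕜) → 𝕜 := fun k u =>
    P.g u t i * (if k = i then 1 else 0) + (u i - c) * P.b u t i k
  let α : (Fin n → 𝕜) → 𝕜 := fun u => P.g u j t
  have hβ₁ : ∀ u ∈ U, ∀ k, DifferentiableAt 𝕜 (β₁ k) u := fun u hu k =>
    DifferentiableAt.mul (by fun_prop) (hs.differentiableAt_b hU hu _ _ _)
  have hβ₂ : ∀ u ∈ U, ∀ k, DifferentiableAt 𝕜 (β₂ k) u := fun u hu k =>
    hs.differentiableAt_b hU hu _ _ _
  have hβ₃ : ∀ u ∈ U, ∀ k, DifferentiableAt 𝕜 (β₃ k) u := fun u hu k =>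
    ((hs.differentiableAt_g hU hu _ _).mul_const _).add
      (DifferentiableAt.mul (by fun_prop) (hs.differentiableAt_b hU hu _ _ _))
  have hα : ∀ u ∈ U, DifferentiableAt 𝕜 α u := fun u hu => hs.differentiableAt_g hU hu _ _
  have h₁ : P.bracket f h = affineDensity (fun _ => 1) (fun _ => 0) β₁ 0 := by
    rw [bracket_of_varDeriv_eq_single P (varDeriv_quadraticDensity i c)]
    funext x w
    rw [apply_varDeriv_linearDensity]
    simp [affineDensity, β₁, Finset.mul_sum, mul_assoc]
  have h₂ : P.bracket h q = affineDensity (fun x => x ^ 2) (fun x => 2 * x) β₂ α := by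
    rw [bracket_of_varDeriv_eq_single P (varDeriv_linearDensity j _)]
    funext x w
    rw [apply_varDeriv_linearDensity, deriv_sq_id]
    simp only [affineDensity, β₂, α]
    ring
  have h₃ : P.bracket q f = affineDensity (fun x => x ^ 2) (fun _ => 0) β₃ 0 := by
    rw [bracket_of_varDeriv_eq_single P (varDeriv_linearDensity t _)]
    funext x w
    rw [apply_varDeriv_quadraticDensity]
    simp [affineDensity, β₃, Finset.mul_sum, add_mul, Finset.sum_add_distrib, mul_assoc]
  have hd0 : ∀ u, DifferentiableAt 𝕜 (0 : (Fin n → 𝕜) → 𝕜) u := fun u => differentiableAt_const 0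
  have hpd0 : ∀ s u, pd s (0 : (Fin n → 𝕜) → 𝕜) u = 0 := fun s u => by simp [pd]
  let R : (Fin n → (Fin n → 𝕜) → 𝕜) → (Fin n → 𝕜) → Fin n → Fin n → 𝕜 := fun β u s k =>
    pd s (β k) u - pd k (β s) u
  have hT : ∀ x (w : ℕ → Fin n → 𝕜), w 0 ∈ U → P.bracket (P.bracket f h) q x w
      + P.bracket (P.bracket h q) f x w + P.bracket (P.bracket q f) h x w
      = (∑ s, (∑ k, R β₁ (w 0) s k * w 1 k)
          * (P.g (w 0) s t * (2 * x) + x ^ 2 * ∑ k, P.b (w 0) s t k * w 1 k))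
        + (∑ s, (x ^ 2 * (∑ k, R β₂ (w 0) s k * w 1 k)
            + (2 * x * pd s α (w 0) - 2 * x * β₂ s (w 0)))
          * (P.g (w 0) s i * w 1 i + (w 0 i - c) * ∑ k, P.b (w 0) s i k * w 1 k))
        + ∑ s, (x ^ 2 * (∑ k, R β₃ (w 0) s k * w 1 k) - 2 * x * β₃ s (w 0))
          * ∑ k, P.b (w 0) s j k * w 1 k := by
    intro x w hw
    rw [h₁, h₂, h₃]
    simp only [bracket]
    refine congrArg₂ _ (congrArg₂ _ (Finset.sum_congr rfl fun s _ => ?_)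
      (Finset.sum_congr rfl fun s _ => ?_)) (Finset.sum_congr rfl fun s _ => ?_)
    · rw [varDeriv_affineDensity (by fun_prop) (hβ₁ _ hw) (hd0 _), apply_varDeriv_linearDensity,
        deriv_sq_id]
      simp [R]
    · rw [varDeriv_affineDensity (by fun_prop) (hβ₂ _ hw) (hα _ hw),
        apply_varDeriv_quadraticDensity, deriv_sq_id]
    · rw [varDeriv_affineDensity (by fun_prop) (hβ₃ _ hw) (hd0 _), apply_varDeriv_linearDensity,
        deriv_sq_id]
      simp [R, hpd0, sub_eq_add_neg]
  have key := hz.deriv_eq_fderiv hU (Pi.single k 1)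
    (fun l x u τ hu => by
      rw [hT x _ (by simpa using hu), hT x _ (by simpa using hu)]
      simp)
    (A := fun _ _ => 0)
    (B := fun x u => x * (2 * ∑ s, (R β₁ u s k * P.g u s t
      + (pd s α u - β₂ s u) * (P.g u s i * (if k = i then 1 else 0) + (u i - c) * P.b u s i k)
      - β₃ s u * P.b u s j k)))
    (fun x u hu => by
      rw [hT x _ (by simpa using hu)]
      simp)
    (fun x u hu => by
      have e : (fun τ : 𝕜 =>
        P.bracket (P.bracket f h) q x (Pi.single 0 u + Pi.single 1 (τ • Pi.single k 1))
        + P.bracket (P.bracket h q) f x (Pi.single 0 u + Pi.single 1 (τ • Pi.single k 1))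
        + P.bracket (P.bracket q f) h x (Pi.single 0 u + Pi.single 1 (τ • Pi.single k 1)))
        = fun τ => (∑ s, (R β₁ u s k * τ) * (P.g u s t * (2 * x) + x ^ 2 * (P.b u s t k * τ)))
        + (∑ s, (x ^ 2 * (R β₂ u s k * τ) + (2 * x * pd s α u - 2 * x * β₂ s u))
          * (P.g u s i * ((if k = i then 1 else 0) * τ) + (u i - c) * (P.b u s i k * τ)))
        + ∑ s, (x ^ 2 * (R β₃ u s k * τ) - 2 * x * β₃ s u) * (P.b u s j k * τ) := by
        funext τ
        rw [hT x _ (by simpa using hu)]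
        simp [Pi.single_apply, eq_comm]
      rw [e]
      have h0 : HasDerivAt (fun τ : 𝕜 => τ) 1 0 := hasDerivAt_id 0
      have h1 := ((HasDerivAt.fun_sum fun (s : Fin n) (_ : s ∈ Finset.univ) =>
        (h0.const_mul (R β₁ u s k)).mul
          (((h0.const_mul (P.b u s t k)).const_mul (x ^ 2)).const_add (P.g u s t * (2 * x)))).add
        (HasDerivAt.fun_sum fun (s : Fin n) (_ : s ∈ Finset.univ) =>
        (((h0.const_mul (R β₂ u s k)).const_mul (x ^ 2)).add_const
          (2 * x * pd s α u - 2 * x * β₂ s u)).mul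
          (((h0.const_mul (if k = i then 1 else 0)).const_mul (P.g u s i)).add
            ((h0.const_mul (P.b u s i k)).const_mul (u i - c))))).add
        (HasDerivAt.fun_sum fun (s : Fin n) (_ : s ∈ Finset.univ) =>
        (((h0.const_mul (R β₃ u s k)).const_mul (x ^ 2)).sub_const (2 * x * β₃ s u)).mul
          (h0.const_mul (P.b u s j k)))
      refine h1.congr_deriv ?_
      simp only [Pi.add_apply, mul_zero, add_zero, zero_mul, mul_one, zero_add, zero_sub]
      rw [← Finset.sum_add_distrib, ← Finset.sum_add_distrib, ← mul_assoc, Finset.mul_sum]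
      refine Finset.sum_congr rfl fun s _ => ?_
      ring) 0 hu
  rw [deriv_mul_const_field, deriv_id'', one_mul] at key
  exact (mul_eq_zero.1 (key.trans (by simp))).resolve_left two_ne_zero

/-- The parameter `c` is free: `c = u i` isolates the term without the factor `u i - c`, and `c = u
i - 1` makes this factor one. The same two choices serve for all identities below. -/
theorem IsHamiltonian.g_symm {P : DNOperator 𝕜 n} {U : Set (Fin n → 𝕜)} (hU : IsOpen U)
    (hs : P.SmoothOn U) (hP : P.IsHamiltonian U) {u : Fin n → 𝕜} (hu : u ∈ U) (i j : Fin n) :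
    P.g u i j = P.g u j i := by
  have := hP.skew hU hs hu i j i (u i)
  simpa [sub_eq_zero] using this

theorem IsHamiltonian.pd_g {P : DNOperator 𝕜 n} {U : Set (Fin n → 𝕜)} (hU : IsOpen U)
    (hs : P.SmoothOn U) (hP : P.IsHamiltonian U) {u : Fin n → 𝕜} (hu : u ∈ U) (i j k : Fin n) :
    pd k (fun u => P.g u i j) u = P.b u i j k + P.b u j i k := by
  have h := hP.skew hU hs hu i j k (u i - 1)
  rw [hP.g_symm hU hs hu i j] at h
  simp only [sub_self, ite_self] at h
  linear_combination h

theorem pd_coord_sub_mul {f : (Fin n → 𝕜) → 𝕜} {u : Fin n → 𝕜} (hf : DifferentiableAt 𝕜 f u)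
    (s i : Fin n) (c : 𝕜) : pd s (fun u => (u i - c) * f u) u
      = (u i - c) * pd s f u + f u * if s = i then 1 else 0 := by
  rw [← pd_coord_sub s i c u]
  exact pd_mul (by fun_prop) hf s

theorem IsHamiltonian.jacobi_expanded {P : DNOperator 𝕜 n} {U : Set (Fin n → 𝕜)} (hU : IsOpen U)
    (hs : P.SmoothOn U) (hP : P.IsHamiltonian U) {u : Fin n → 𝕜} (hu : u ∈ U) (i j t k : Fin n)
    (c : 𝕜) :
    (u i - c) * (∑ s, ((pd s (fun u => P.b u i j k) u - pd k (fun u => P.b u i j s) u) * P.g u s t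
        + P.b u t j s * P.b u s i k - P.b u t i s * P.b u s j k))
      + (if k = i then 1 else 0) * (∑ s, (P.b u t j s * P.g u s i - P.b u i j s * P.g u s t))
      = 0 := by
  have h := hP.jacobi hU hs hu i j t k c
  simp only [pd_coord_sub_mul (hs.differentiableAt_b hU hu _ _ _), hP.pd_g hU hs hu,
    add_sub_cancel_left] at h
  -- The two contributions obtained by differentiating `u i - c` and the metric term of the third
  -- bracket cancel by symmetry of `g`.
  have h2 : ∑ s, (P.b u i j k * (if s = i then 1 else 0) * P.g u s t
      - P.g u t i * (if s = i then 1 else 0) * P.b u s j k) = 0 := by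
    rw [Finset.sum_sub_distrib]
    simp [hP.g_symm hU hs hu i t, mul_comm]
  refine Eq.trans ?_ ((congrArg₂ (· - ·) h h2).trans (sub_zero 0))
  rw [Finset.mul_sum, Finset.mul_sum, ← Finset.sum_add_distrib, ← Finset.sum_sub_distrib]
  refine Finset.sum_congr rfl fun s _ => ?_
  ring

theorem IsHamiltonian.g_b_symm {P : DNOperator 𝕜 n} {U : Set (Fin n → 𝕜)} (hU : IsOpen U)
    (hs : P.SmoothOn U) (hP : P.IsHamiltonian U) {u : Fin n → 𝕜} (hu : u ∈ U) (i j t : Fin n) :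
    ∑ s, P.b u t j s * P.g u s i = ∑ s, P.b u i j s * P.g u s t := by
  have h := hP.jacobi_expanded hU hs hu i j t i (u i)
  rw [Finset.sum_sub_distrib (fun s => P.b u t j s * P.g u s i)] at h
  simpa [sub_eq_zero] using h

theorem IsHamiltonian.flat {P : DNOperator 𝕜 n} {U : Set (Fin n → 𝕜)} (hU : IsOpen U)
    (hs : P.SmoothOn U) (hP : P.IsHamiltonian U) {u : Fin n → 𝕜} (hu : u ∈ U) (i j t k : Fin n) :
    ∑ s, ((pd s (fun u => P.b u i j k) u - pd k (fun u => P.b u i j s) u) * P.g u s t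
        + P.b u t j s * P.b u s i k - P.b u t i s * P.b u s j k) = 0 := by
  have h := hP.jacobi_expanded hU hs hu i j t k (u i - 1)
  rw [Finset.sum_sub_distrib (fun s => P.b u t j s * P.g u s i), hP.g_b_symm hU hs hu i j t] at h
  simpa using h

end DNOperator

/-! ### Calculus of second partial derivatives. -/

section

variable {𝕜 : Type*} [RCLike 𝕜] {n : ℕ}

theorem pd_congr {f h : (Fin n → 𝕜) → 𝕜} {V : Set (Fin n → 𝕜)} (hV : IsOpen V)
    (hfh : ∀ u ∈ V, f u = h u) {u : Fin n → 𝕜} (hu : u ∈ V) (k : Fin n) : pd k f u = pd k h u := by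
  have : f =ᶠ[𝓝 u] h := Filter.eventuallyEq_of_mem (hV.mem_nhds hu) hfh
  rw [pd, this.fderiv_eq, pd]

theorem pd_const (c : 𝕜) (k : Fin n) (u : Fin n → 𝕜) : pd k (fun _ => c) u = 0 := by
  simp [pd]

theorem contDiffOn_pd {f : (Fin n → 𝕜) → 𝕜} {V : Set (Fin n → 𝕜)} (hV : IsOpen V)
    (hf : ContDiffOn 𝕜 ∞ f V) (k : Fin n) : ContDiffOn 𝕜 ∞ (pd k f) V :=
  (hf.fderiv_of_isOpen hV (m := ∞) (by simp)).clm_apply contDiffOn_const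

theorem pd_comm {f : (Fin n → 𝕜) → 𝕜} {V : Set (Fin n → 𝕜)} (hV : IsOpen V)
    (hf : ContDiffOn 𝕜 ∞ f V) {u : Fin n → 𝕜} (hu : u ∈ V) (k l : Fin n) :
    pd k (pd l f) u = pd l (pd k f) u := by
  have h2 : HasFDerivAt (fderiv 𝕜 f) (fderiv 𝕜 (fderiv 𝕜 f) u) u :=
    (((hf.contDiffAt (hV.mem_nhds hu)).fderiv_right (m := ∞)
      (by simp)).differentiableAt (by simp)).hasFDerivAt
  have h3 : ∀ k l, pd k (pd l f) u
      = fderiv 𝕜 (fderiv 𝕜 f) u (Pi.single k 1) (Pi.single l 1) := by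
    intro k l
    have h4 : HasFDerivAt (pd l f) _ u := h2.clm_apply (hasFDerivAt_const (Pi.single l 1) u)
    rw [pd, h4.fderiv]
    simp
  rw [h3, h3]
  exact (hf.contDiffAt (hV.mem_nhds hu)).isSymmSndFDerivAt
    (by rw [minSmoothness_of_isRCLikeNormedField]; exact ENat.LEInfty.out) _ _

end

/-! ### Poisson conditions and the normal form of the coefficients in rank at most one. -/

namespace DNOperator

variable {𝕜 : Type*} [RCLike 𝕜]

/-- The differential conditions on the coefficients of a Hamiltonian operator. -/
structure IsPoissonOn {n : ℕ} (P : DNOperator 𝕜 n) (U : Set (Fin n → 𝕜)) : Prop where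
  smooth : P.SmoothOn U
  g_symm : ∀ u ∈ U, ∀ i j, P.g u i j = P.g u j i
  pd_g : ∀ u ∈ U, ∀ i j k, pd k (fun u => P.g u i j) u = P.b u i j k + P.b u j i k
  g_b_symm : ∀ u ∈ U, ∀ i j t, ∑ s, P.b u t j s * P.g u s i = ∑ s, P.b u i j s * P.g u s t
  flat : ∀ u ∈ U, ∀ i j t k,
    ∑ s, ((pd s (fun u => P.b u i j k) u - pd k (fun u => P.b u i j s) u) * P.g u s t
        + P.b u t j s * P.b u s i k - P.b u t i s * P.b u s j k) = 0

theorem IsHamiltonian.isPoissonOn {n : ℕ} {P : DNOperator 𝕜 n} {U : Set (Fin n → 𝕜)}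
    (hU : IsOpen U) (hs : P.SmoothOn U) (hP : P.IsHamiltonian U) : P.IsPoissonOn U where
  smooth := hs
  g_symm _ hu := hP.g_symm hU hs hu
  pd_g _ hu := hP.pd_g hU hs hu
  g_b_symm _ hu := hP.g_b_symm hU hs hu
  flat _ hu := hP.flat hU hs hu

theorem pd_neg {n : ℕ} (f : (Fin n → 𝕜) → 𝕜) (k : Fin n) (u : Fin n → 𝕜) :
    pd k (fun u => -f u) u = -pd k f u := by
  simp [pd, fderiv_fun_neg]

theorem IsPoissonOn.neg {n : ℕ} {P : DNOperator 𝕜 n} {U : Set (Fin n → 𝕜)}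
    (hP : P.IsPoissonOn U) : P.neg.IsPoissonOn U where
  smooth := ⟨fun i j => (hP.smooth.1 i j).neg, fun i j k => (hP.smooth.2 i j k).neg⟩
  g_symm u hu i j := congrArg (-·) (hP.g_symm u hu i j)
  pd_g u hu i j k := by
    have := hP.pd_g u hu i j k
    simp only [DNOperator.neg, Matrix.neg_apply, Pi.neg_apply]
    rw [pd_neg, this]
    ring
  g_b_symm u hu i j t := by
    simpa [DNOperator.neg] using hP.g_b_symm u hu i j t
  flat u hu i j t k := by
    rw [← hP.flat u hu i j t k]
    refine Finset.sum_congr rfl fun s _ => ?_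
    simp only [DNOperator.neg, Matrix.neg_apply, Pi.neg_apply]
    rw [pd_neg, pd_neg]
    ring

theorem IsPoissonOn.mono {n : ℕ} {P : DNOperator 𝕜 n} {U V : Set (Fin n → 𝕜)}
    (hP : P.IsPoissonOn U) (hVU : V ⊆ U) : P.IsPoissonOn V where
  smooth := ⟨fun i j => (hP.smooth.1 i j).mono hVU, fun i j k => (hP.smooth.2 i j k).mono hVU⟩
  g_symm u hu := hP.g_symm u (hVU hu)
  pd_g u hu := hP.pd_g u (hVU hu)
  g_b_symm u hu := hP.g_b_symm u (hVU hu)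
  flat u hu := hP.flat u (hVU hu)

/-- For `g = 0` the coefficients are skew in the upper indices, so with two components only
`b^{01}_k` remain; flatness, purely quadratic in `b`, then contains the square of each. -/
theorem IsPoissonOn.b_eq_zero {P : DNOperator 𝕜 2} {V : Set (Fin 2 → 𝕜)} (hV : IsOpen V)
    (hP : P.IsPoissonOn V) (hg : ∀ u ∈ V, P.g u = 0) {u : Fin 2 → 𝕜} (hu : u ∈ V) :
    P.b u = 0 := by
  have hskew : ∀ i j k, P.b u i j k + P.b u j i k = 0 := by
    intro i j k
    rw [← hP.pd_g u hu i j k, pd_congr (h := fun _ => 0) hV (fun u hu => by rw [hg u hu]; rfl) hu,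
      pd_const]
  have hdiag : ∀ i k, P.b u i i k = 0 := fun i k => by
    have h := hskew i i k
    rwa [← two_mul, mul_eq_zero, or_iff_right two_ne_zero] at h
  have hanti : ∀ k, P.b u 1 0 k = -P.b u 0 1 k := fun k => by linear_combination hskew 1 0 k
  have hflat := fun t k => hP.flat u hu 0 1 t k
  simp only [hg u hu, Fin.sum_univ_two, Matrix.zero_apply, hdiag, hanti, mul_zero, zero_add,
    sub_zero, zero_sub] at hflat
  have h0 := hflat 1 0
  have h1 := hflat 0 1
  simp only [hdiag, hanti] at h0 h1
  have h0' : P.b u 0 1 0 = 0 := by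
    have : P.b u 0 1 0 ^ 2 = 0 := by linear_combination h0
    exact pow_eq_zero_iff two_ne_zero |>.1 this
  have h1' : P.b u 0 1 1 = 0 := by
    have : P.b u 0 1 1 ^ 2 = 0 := by linear_combination -h1
    exact pow_eq_zero_iff two_ne_zero |>.1 this
  funext i j k
  fin_cases i <;> fin_cases j <;> fin_cases k <;> simp [hdiag, hanti, h0', h1']

/-- The covector `(-v², v¹)` annihilating `v`. -/
def normal (v : Fin 2 → 𝕜) : Fin 2 → 𝕜 := ![-v 1, v 0]

/-- On `V`, `P` has the metric `v ⊗ v` and its coefficients `b` differ from those of the operator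
with the constant form by the tensor `μ ε ⊗ normal v`, where `v(μ) = μ²`. -/
structure HasRankOneForm (P : DNOperator 𝕜 2) (V : Set (Fin 2 → 𝕜))
    (v : (Fin 2 → 𝕜) → Fin 2 → 𝕜) (μ : (Fin 2 → 𝕜) → 𝕜) : Prop where
  contDiffOn_v : ContDiffOn 𝕜 ∞ v V
  contDiffOn_μ : ContDiffOn 𝕜 ∞ μ V
  v_ne_zero : ∀ u ∈ V, v u ≠ 0
  g_eq : ∀ u ∈ V, ∀ i j, P.g u i j = v u i * v u j
  b_eq : ∀ u ∈ V, ∀ i j k, P.b u i j k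
    = v u i * pd k (fun u => v u j) u + μ u * normal (v u) k * !![0, 1; -1, 0] i j
  riccati : ∀ u ∈ V, ∑ k, v u k * pd k μ u = μ u ^ 2

theorem HasRankOneForm.mono {P : DNOperator 𝕜 2} {V W : Set (Fin 2 → 𝕜)}
    {v : (Fin 2 → 𝕜) → Fin 2 → 𝕜} {μ : (Fin 2 → 𝕜) → 𝕜} (h : P.HasRankOneForm V v μ)
    (hWV : W ⊆ V) : P.HasRankOneForm W v μ where
  contDiffOn_v := h.contDiffOn_v.mono hWV
  contDiffOn_μ := h.contDiffOn_μ.mono hWV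
  v_ne_zero u hu := h.v_ne_zero u (hWV hu)
  g_eq u hu := h.g_eq u (hWV hu)
  b_eq u hu := h.b_eq u (hWV hu)
  riccati u hu := h.riccati u (hWV hu)

theorem IsPoissonOn.exists_hasRankOneForm {P : DNOperator 𝕜 2} {V : Set (Fin 2 → 𝕜)}
    (hV : IsOpen V) (hP : P.IsPoissonOn V) {v : (Fin 2 → 𝕜) → Fin 2 → 𝕜}
    (hv : ContDiffOn 𝕜 ∞ v V) (hg : ∀ u ∈ V, ∀ i j, P.g u i j = v u i * v u j) {m : Fin 2}
    (hm : ∀ u ∈ V, v u m ≠ 0) : ∃ μ, P.HasRankOneForm V v μ := by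
  have hvi : ∀ i, ContDiffOn 𝕜 ∞ (fun u => v u i) V := fun i => contDiffOn_pi.1 hv i
  have hd : ∀ i, ∀ u ∈ V, DifferentiableAt 𝕜 (fun u => v u i) u := fun i u hu =>
    ((hvi i).contDiffAt (hV.mem_nhds hu)).differentiableAt (by simp)
  have hsum : ∀ u ∈ V, ∀ i j k, P.b u i j k + P.b u j i k
      = v u i * pd k (fun u => v u j) u + v u j * pd k (fun u => v u i) u := by
    intro u hu i j k
    rw [← hP.pd_g u hu i j k, pd_congr hV (fun u hu => hg u hu i j) hu,
      pd_mul (hd i u hu) (hd j u hu)]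
  have hdiag : ∀ u ∈ V, ∀ i k, P.b u i i k = v u i * pd k (fun u => v u i) u := by
    intro u hu i k
    have h : (2 : 𝕜) * (P.b u i i k - v u i * pd k (fun u => v u i) u) = 0 := by
      linear_combination hsum u hu i i k
    exact sub_eq_zero.1 ((mul_eq_zero.1 h).resolve_left two_ne_zero)
  -- The symmetric part of `b` is fixed by the derivatives of `g`; `σ` is the only remaining
  -- freedom, the skew part left after subtracting `v^i ∂_k v^j`.
  let σ : Fin 2 → (Fin 2 → 𝕜) → 𝕜 := fun k u => P.b u 0 1 k - v u 0 * pd k (fun u => v u 1) u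
  have hσ : ∀ k, ContDiffOn 𝕜 ∞ (σ k) V := fun k =>
    (hP.smooth.2 0 1 k).sub ((hvi 0).mul (contDiffOn_pd hV (hvi 1) k))
  have h01 : ∀ u k, P.b u 0 1 k = v u 0 * pd k (fun u => v u 1) u + σ k u := fun u k => by
    simp [σ]
  have h10 : ∀ u ∈ V, ∀ k, P.b u 1 0 k = v u 1 * pd k (fun u => v u 0) u - σ k u := fun u hu k => by
    linear_combination hsum u hu 1 0 k - h01 u k
  -- The symmetry of `b` contracted with `g` makes `σ` annihilate `v`; in two dimensions it is then
  -- a multiple `μ` of the normal covector, and dividing by the nonvanishing component `m` keeps `μ`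
  -- smooth.
  have hσv : ∀ u ∈ V, σ 0 u * v u 0 + σ 1 u * v u 1 = 0 := by
    intro u hu
    have h := hP.g_b_symm u hu 1 1 0
    have h' := hP.g_b_symm u hu 0 0 1
    simp only [Fin.sum_univ_two, hg u hu, hdiag u hu, h01 u, h10 u hu] at h h'
    have hz : ∀ i, (σ 0 u * v u 0 + σ 1 u * v u 1) * v u i = 0 := by
      intro i
      fin_cases i
      · simp only [Fin.zero_eta]
        linear_combination -h'
      · simp only [Fin.mk_one]
        linear_combination h
    exact (mul_eq_zero.1 (hz m)).resolve_right (hm u hu)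
  obtain ⟨μ, hμs, hμ⟩ : ∃ μ : (Fin 2 → 𝕜) → 𝕜, ContDiffOn 𝕜 ∞ μ V ∧
      ∀ u ∈ V, ∀ k, σ k u = μ u * normal (v u) k := by
    have hm' : m = 0 ∨ m = 1 := by fin_cases m <;> simp
    rcases hm' with rfl | rfl
    · refine ⟨fun u => σ 1 u / v u 0, (hσ 1).div (hvi 0) hm, fun u hu k => ?_⟩
      have h0 := hm u hu
      have h1 := hσv u hu
      fin_cases k
      · simp [normal]
        field_simp
        linear_combination h1
      · simp [normal]
        field_simp
    · refine ⟨fun u => -σ 0 u / v u 1, (hσ 0).neg.div (hvi 1) hm, fun u hu k => ?_⟩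
      have h0 := hm u hu
      have h1 := hσv u hu
      fin_cases k
      · simp [normal]
        field_simp
      · simp [normal]
        field_simp
        linear_combination h1
  have hdμ : ∀ u ∈ V, DifferentiableAt 𝕜 μ u := fun u hu =>
    (hμs.contDiffAt (hV.mem_nhds hu)).differentiableAt (by simp)
  have hdp : ∀ i k, ∀ u ∈ V, DifferentiableAt 𝕜 (pd k fun u => v u i) u := fun i k u hu =>
    ((contDiffOn_pd hV (hvi i) k).contDiffAt (hV.mem_nhds hu)).differentiableAt (by simp)
  have hb : ∀ u ∈ V, ∀ i j k, P.b u i j k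
    = v u i * pd k (fun u => v u j) u + μ u * normal (v u) k * !![0, 1; -1, 0] i j := by
    intro u hu i j k
    fin_cases i <;> fin_cases j
    · simpa using hdiag u hu 0 k
    · simpa [hμ u hu k] using h01 u k
    · have := h10 u hu k
      rw [hμ u hu k] at this
      simp
      linear_combination this
    · simpa using hdiag u hu 1 k
  refine ⟨μ, hv, hμs, fun u hu h0 => hm u hu (by rw [h0]; rfl), hg, hb, fun u hu => ?_⟩
  have hpdb0 : ∀ s, pd s (fun u => P.b u 0 1 0) u
      = v u 0 * pd s (pd 0 fun u => v u 1) u + pd 0 (fun u => v u 1) u * pd s (fun u => v u 0) u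
        + -(μ u * pd s (fun u => v u 1) u + v u 1 * pd s μ u) := by
    intro s
    rw [pd_congr (h := fun u => v u 0 * pd 0 (fun u => v u 1) u + -(μ u * v u 1)) hV
      (fun u hu => by rw [hb u hu]; simp [normal]) hu,
      pd_add ((hd 0 u hu).fun_mul (hdp 1 0 u hu)) ((hdμ u hu).fun_mul (hd 1 u hu)).fun_neg,
      pd_mul (hd 0 u hu) (hdp 1 0 u hu), pd_neg, pd_mul (hdμ u hu) (hd 1 u hu)]
  have hpdb1 : ∀ s, pd s (fun u => P.b u 0 1 1) u
      = v u 0 * pd s (pd 1 fun u => v u 1) u + pd 1 (fun u => v u 1) u * pd s (fun u => v u 0) u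
        + (μ u * pd s (fun u => v u 0) u + v u 0 * pd s μ u) := by
    intro s
    rw [pd_congr (h := fun u => v u 0 * pd 1 (fun u => v u 1) u + μ u * v u 0) hV
      (fun u hu => by rw [hb u hu]; simp [normal]) hu,
      pd_add ((hd 0 u hu).fun_mul (hdp 1 1 u hu)) ((hdμ u hu).fun_mul (hd 0 u hu)),
      pd_mul (hd 0 u hu) (hdp 1 1 u hu), pd_mul (hdμ u hu) (hd 0 u hu)]
  have hcomm := pd_comm hV (hvi 1) hu 1 0
  have hflat := fun t k => hP.flat u hu 0 1 t k
  -- After the second derivatives of `v` cancel, flatness is the Riccati defect times `v ⊗ n`. For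
  -- each `m`, the index pair chosen below makes the prefactor `±(v u m)²`.
  have key : ∀ t k, v u t * normal (v u) k * (v u 0 * pd 0 μ u + v u 1 * pd 1 μ u - μ u ^ 2) = 0 := by
    intro t k
    have h := hflat t k
    fin_cases k <;> fin_cases t <;>
    · simp [-mul_eq_zero, Fin.sum_univ_two, hpdb0, hpdb1, hg u hu, hb u hu, normal, hcomm] at h ⊢
      first | linear_combination h | linear_combination -h
  rw [Fin.sum_univ_two, ← sub_eq_zero]
  have hm' : m = 0 ∨ m = 1 := by fin_cases m <;> simp
  rcases hm' with rfl | rfl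
  · exact (mul_eq_zero.1 (key 0 1)).resolve_left (mul_ne_zero (hm u hu) (hm u hu))
  · exact (mul_eq_zero.1 (key 1 0)).resolve_left (mul_ne_zero (hm u hu) (neg_ne_zero.2 (hm u hu)))

end DNOperator

/-! ### Changes of variables and the two canonical forms. -/

namespace DNOperator

variable {𝕜 : Type*} [RCLike 𝕜]

section Jacobians

variable {n : ℕ} {V : Set (Fin n → 𝕜)} {p : Fin n → 𝕜}
  {φ : OpenPartialHomeomorph (Fin n → 𝕜) (Fin n → 𝕜)}

theorem IsChangeOfVariables.differentiableAt (hφ : IsChangeOfVariables V p φ) {u : Fin n → 𝕜}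
    (hu : u ∈ φ.source) : DifferentiableAt 𝕜 φ u :=
  (hφ.2.2.1.contDiffAt (φ.open_source.mem_nhds hu)).differentiableAt (by simp)

theorem IsChangeOfVariables.differentiableAt_symm (hφ : IsChangeOfVariables V p φ)
    {x : Fin n → 𝕜} (hx : x ∈ φ.target) : DifferentiableAt 𝕜 φ.symm x :=
  (hφ.2.2.2.contDiffAt (φ.open_target.mem_nhds hx)).differentiableAt (by simp)

theorem IsChangeOfVariables.contDiffOn_jac (hφ : IsChangeOfVariables V p φ) (l j : Fin n) :
    ContDiffOn 𝕜 ∞ (jac φ l j) φ.source :=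
  contDiffOn_pi.1 ((hφ.2.2.1.fderiv_of_isOpen φ.open_source (m := ∞) (by simp)).clm_apply
    contDiffOn_const) l

theorem fderiv_apply_eq_sum_jac (f : (Fin n → 𝕜) → Fin n → 𝕜) (u e : Fin n → 𝕜) (l : Fin n) :
    fderiv 𝕜 f u e l = ∑ i, jac f l i u * e i := by
  conv_lhs => rw [pi_eq_sum_univ' e, map_sum]
  rw [Finset.sum_apply]
  refine Finset.sum_congr rfl fun i _ => ?_
  rw [map_smul, Pi.smul_apply, smul_eq_mul, mul_comm]
  simp [jac]

theorem IsChangeOfVariables.jac_mul_jac_symm (hφ : IsChangeOfVariables V p φ) {u : Fin n → 𝕜}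
    (hu : u ∈ φ.source) :
    (Matrix.of fun l i => jac φ l i u) * (Matrix.of fun i l => jac φ.symm i l (φ u)) = 1 := by
  have hx := φ.map_source hu
  have h1 : HasFDerivAt φ (fderiv 𝕜 φ u) (φ.symm (φ u)) := by
    rw [φ.left_inv hu]
    exact (hφ.differentiableAt hu).hasFDerivAt
  have h2 := h1.comp (φ u) (hφ.differentiableAt_symm hx).hasFDerivAt
  have h3 : HasFDerivAt (φ ∘ φ.symm) (ContinuousLinearMap.id 𝕜 (Fin n → 𝕜)) (φ u) :=
    (hasFDerivAt_id _).congr_of_eventuallyEq (φ.eventually_right_inverse hx)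
  ext l r
  have h4 := congrFun (DFunLike.congr_fun (h2.unique h3) (Pi.single r 1)) l
  rw [ContinuousLinearMap.comp_apply, fderiv_apply_eq_sum_jac] at h4
  rw [Matrix.mul_apply]
  refine h4.trans ?_
  simp [Matrix.one_apply, Pi.single_apply]

theorem IsChangeOfVariables.sum_jac_mul_jac_symm (hφ : IsChangeOfVariables V p φ) {u : Fin n → 𝕜}
    (hu : u ∈ φ.source) (l r : Fin n) :
    ∑ k, jac φ l k u * jac φ.symm k r (φ u) = if l = r then 1 else 0 := by
  have := congrFun (congrFun (hφ.jac_mul_jac_symm hu) l) r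
  rwa [Matrix.mul_apply, Matrix.one_apply] at this

theorem IsChangeOfVariables.sum_jac_symm_mul_jac (hφ : IsChangeOfVariables V p φ) {u : Fin n → 𝕜}
    (hu : u ∈ φ.source) (k i : Fin n) :
    ∑ s, jac φ.symm k s (φ u) * jac φ s i u = if k = i then 1 else 0 := by
  have h := mul_eq_one_comm.1 (hφ.jac_mul_jac_symm hu)
  have := congrFun (congrFun h k) i
  rwa [Matrix.mul_apply, Matrix.one_apply] at this

theorem IsChangeOfVariables.restrOpen (hφ : IsChangeOfVariables V p φ) {W : Set (Fin n → 𝕜)}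
    (hW : IsOpen W) (hp : p ∈ W) : IsChangeOfVariables W p (φ.restrOpen W hW) :=
  ⟨⟨hφ.1, hp⟩, fun _ hu => hu.2, hφ.2.2.1.mono fun _ hu => hu.1,
    hφ.2.2.2.mono fun _ hx => hx.1⟩

theorem IsChangeOfVariables.mono (hφ : IsChangeOfVariables V p φ) {W : Set (Fin n → 𝕜)}
    (hVW : V ⊆ W) : IsChangeOfVariables W p φ :=
  ⟨hφ.1, hφ.2.1.trans hVW, hφ.2.2⟩

end Jacobians

/-- The `l`-th component of the vector field `v` in the variables `φ(u)`. -/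
noncomputable def pushforward (φ v : (Fin 2 → 𝕜) → Fin 2 → 𝕜) (l : Fin 2) (u : Fin 2 → 𝕜) : 𝕜 :=
  ∑ i, jac φ l i u * v u i

variable {P : DNOperator 𝕜 2} {V : Set (Fin 2 → 𝕜)} {v : (Fin 2 → 𝕜) → Fin 2 → 𝕜}
  {μ : (Fin 2 → 𝕜) → 𝕜} {p : Fin 2 → 𝕜} {φ : OpenPartialHomeomorph (Fin 2 → 𝕜) (Fin 2 → 𝕜)}

theorem HasRankOneForm.differentiableAt_v (h : P.HasRankOneForm V v μ) (hV : IsOpen V)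
    {u : Fin 2 → 𝕜} (hu : u ∈ V) (i : Fin 2) : DifferentiableAt 𝕜 (fun u => v u i) u :=
  ((contDiffOn_pi.1 h.contDiffOn_v i).contDiffAt (hV.mem_nhds hu)).differentiableAt (by simp)

theorem IsChangeOfVariables.differentiableAt_jac (hφ : IsChangeOfVariables V p φ)
    {u : Fin 2 → 𝕜} (hu : u ∈ φ.source) (l i : Fin 2) : DifferentiableAt 𝕜 (jac φ l i) u :=
  ((hφ.contDiffOn_jac l i).contDiffAt (φ.open_source.mem_nhds hu)).differentiableAt (by simp)

theorem HasRankOneForm.differentiableAt_pushforward (h : P.HasRankOneForm V v μ) (hV : IsOpen V)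
    (hφ : IsChangeOfVariables V p φ) {u : Fin 2 → 𝕜} (hu : u ∈ φ.source) (l : Fin 2) :
    DifferentiableAt 𝕜 (pushforward φ v l) u :=
  DifferentiableAt.fun_sum fun i _ =>
    (hφ.differentiableAt_jac hu l i).mul (h.differentiableAt_v hV (hφ.2.1 hu) i)

theorem HasRankOneForm.pd_pushforward (h : P.HasRankOneForm V v μ) (hV : IsOpen V)
    (hφ : IsChangeOfVariables V p φ) {u : Fin 2 → 𝕜} (hu : u ∈ φ.source) (l k : Fin 2) :
    pd k (pushforward φ v l) u
      = ∑ i, (jac φ l i u * pd k (fun u => v u i) u + v u i * hess φ l i k u) := by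
  have hu' := hφ.2.1 hu
  have hj := hφ.differentiableAt_jac hu l
  have hv := h.differentiableAt_v hV hu'
  have : pushforward φ v l = fun u => jac φ l 0 u * v u 0 + jac φ l 1 u * v u 1 := by
    funext u
    simp [pushforward, Fin.sum_univ_two]
  rw [this, pd_add ((hj 0).fun_mul (hv 0)) ((hj 1).fun_mul (hv 1)), pd_mul (hj 0) (hv 0),
    pd_mul (hj 1) (hv 1), Fin.sum_univ_two]
  rfl

theorem HasRankOneForm.transform_g (h : P.HasRankOneForm V v μ)
    (hφ : IsChangeOfVariables V p φ) {u : Fin 2 → 𝕜} (hu : u ∈ φ.source) (l r : Fin 2) :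
    (P.transform φ).g (φ u) l r = pushforward φ v l u * pushforward φ v r u := by
  have hu' := hφ.2.1 hu
  simp only [transform, Matrix.of_apply, φ.left_inv hu, h.g_eq u hu', pushforward,
    Fin.sum_univ_two]
  ring

/-- The inhomogeneous second-derivative term is exactly what turns `v^i ∂_k v^j` into the same
expression for the pushed-forward field, while `ε` is multiplied by minors of the Jacobian matrix.
-/
theorem HasRankOneForm.transform_b (h : P.HasRankOneForm V v μ) (hV : IsOpen V)
    (hφ : IsChangeOfVariables V p φ) {u : Fin 2 → 𝕜} (hu : u ∈ φ.source) (l r s : Fin 2) :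
    (P.transform φ).b (φ u) l r s = ∑ k, (pushforward φ v l u * pd k (pushforward φ v r) u
      + μ u * normal (v u) k * (jac φ l 0 u * jac φ r 1 u - jac φ l 1 u * jac φ r 0 u))
        * jac φ.symm k s (φ u) := by
  have hu' := hφ.2.1 hu
  simp only [transform, φ.left_inv hu, h.g_eq u hu', h.b_eq u hu', h.pd_pushforward hV hφ hu,
    Fin.sum_univ_two, Matrix.cons_val_zero, Matrix.cons_val_one, Matrix.of_apply,
    Matrix.cons_val', Matrix.cons_val_fin_one]
  simp only [pushforward, Fin.sum_univ_two]
  ring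

theorem IsChangeOfVariables.det_ne_zero (hφ : IsChangeOfVariables V p φ) {u : Fin 2 → 𝕜}
    (hu : u ∈ φ.source) : jac φ 0 0 u * jac φ 1 1 u - jac φ 0 1 u * jac φ 1 0 u ≠ 0 := by
  have h1 := congrArg Matrix.det (hφ.jac_mul_jac_symm hu)
  rw [Matrix.det_mul, Matrix.det_one, Matrix.det_fin_two] at h1
  intro h0
  simp only [Matrix.of_apply] at h1
  rw [h0, zero_mul] at h1
  exact zero_ne_one h1

theorem exists_normal_ne_zero {a : Fin 2 → 𝕜} (ha : a ≠ 0) : ∃ k, normal a k ≠ 0 := by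
  by_contra! h
  refine ha (funext fun i => ?_)
  have h0 := h 0
  have h1 := h 1
  simp only [normal, Matrix.cons_val_zero, Matrix.cons_val_one, neg_eq_zero] at h0 h1
  fin_cases i <;> simp [h0, h1]

theorem HasRankOneForm.exists_pushforward_ne_zero (h : P.HasRankOneForm V v μ)
    (hφ : IsChangeOfVariables V p φ) {u : Fin 2 → 𝕜} (hu : u ∈ φ.source) :
    ∃ l, pushforward φ v l u ≠ 0 := by
  by_contra! h0
  refine h.v_ne_zero u (hφ.2.1 hu) (funext fun k => ?_)
  have h1 : ∑ s, jac φ.symm k s (φ u) * pushforward φ v s u = v u k := by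
    simp only [pushforward, Finset.mul_sum, ← mul_assoc]
    rw [Finset.sum_comm]
    simp only [← Finset.sum_mul, hφ.sum_jac_symm_mul_jac hu]
    simp
  rw [← h1]
  simp [h0]

/-- In variables in which the metric is constant, the coefficients `b` vanish exactly where `μ`
does. -/
theorem HasRankOneForm.transform_b_eq_zero_iff (h : P.HasRankOneForm V v μ) (hV : IsOpen V)
    (hφ : IsChangeOfVariables V p φ)
    (hg : ∀ x ∈ φ.target, (P.transform φ).g x = (P.transform φ).g (φ p)) {u : Fin 2 → 𝕜}
    (hu : u ∈ φ.source) : (P.transform φ).b (φ u) = 0 ↔ μ u = 0 := by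
  have hw := h.differentiableAt_pushforward hV hφ hu
  -- Constancy of all products of components of the pushed-forward field, one component being
  -- nonzero at the point, forces every first derivative to vanish there. Only the `μ` term of `b`
  -- remains.
  have hconst : ∀ l r k, pushforward φ v l u * pd k (pushforward φ v r) u
      + pushforward φ v r u * pd k (pushforward φ v l) u = 0 := by
    intro l r k
    rw [← pd_mul (hw l) (hw r), pd_congr (h := fun _ => (P.transform φ).g (φ p) l r)
      φ.open_source (fun u hu => ?_) hu, pd_const]
    rw [← h.transform_g hφ hu, hg _ (φ.map_source hu)]
  obtain ⟨l₀, hl₀⟩ := h.exists_pushforward_ne_zero hφ hu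
  have hpd0 : ∀ k, pd k (pushforward φ v l₀) u = 0 := fun k => by
    have h2 : 2 * pushforward φ v l₀ u * pd k (pushforward φ v l₀) u = 0 := by
      linear_combination hconst l₀ l₀ k
    exact (mul_eq_zero.1 h2).resolve_left (mul_ne_zero two_ne_zero hl₀)
  have hpd : ∀ r k, pd k (pushforward φ v r) u = 0 := fun r k => by
    have h2 := hconst l₀ r k
    rw [hpd0, mul_zero, add_zero] at h2
    exact (mul_eq_zero.1 h2).resolve_left hl₀
  have hb := h.transform_b hV hφ hu
  simp only [hpd, mul_zero, zero_add] at hb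
  constructor
  · intro h0
    obtain ⟨i, hi⟩ := exists_normal_ne_zero (h.v_ne_zero u (hφ.2.1 hu))
    -- Contraction with the Jacobian matrix undoes its inverse in the lower index, leaving `μ` times
    -- two nonzero factors.
    have h1 : ∑ s, (P.transform φ).b (φ u) 0 1 s * jac φ s i u
        = μ u * normal (v u) i * (jac φ 0 0 u * jac φ 1 1 u - jac φ 0 1 u * jac φ 1 0 u) := by
      simp only [hb, Finset.sum_mul, mul_assoc _ (jac φ.symm _ _ _)]
      rw [Finset.sum_comm]
      simp only [← Finset.mul_sum, hφ.sum_jac_symm_mul_jac hu]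
      simp
    rw [h0] at h1
    simp only [Pi.zero_apply, zero_mul, Finset.sum_const_zero] at h1
    have h2 := (mul_eq_zero.1 h1.symm).resolve_right (hφ.det_ne_zero hu)
    exact (mul_eq_zero.1 h2).resolve_right hi
  · intro h0
    funext l r s
    rw [hb, h0]
    simp

theorem pushforward_of_rectified {u : Fin 2 → 𝕜} (hu : fderiv 𝕜 φ u (v u) = Pi.single 0 1)
    (l : Fin 2) : pushforward φ v l u = (Pi.single 0 1 : Fin 2 → 𝕜) l := by
  rw [← hu, fderiv_apply_eq_sum_jac, pushforward]

theorem HasRankOneForm.transform_g_of_rectified (h : P.HasRankOneForm V v μ)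
    (hφ : IsChangeOfVariables V p φ)
    (hrect : ∀ u ∈ φ.source, fderiv 𝕜 φ u (v u) = Pi.single 0 1) {x : Fin 2 → 𝕜}
    (hx : x ∈ φ.target) : (P.transform φ).g x = !![1, 0; 0, 0] := by
  have hu := φ.map_target hx
  have h1 := h.transform_g hφ hu
  rw [φ.right_inv hx] at h1
  ext l r
  rw [h1, pushforward_of_rectified (hrect _ hu), pushforward_of_rectified (hrect _ hu)]
  fin_cases l <;> fin_cases r <;> simp

theorem HasRankOneForm.transform_b_of_rectified (h : P.HasRankOneForm V v μ) (hV : IsOpen V)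
    (hφ : IsChangeOfVariables V p φ)
    (hrect : ∀ u ∈ φ.source, fderiv 𝕜 φ u (v u) = Pi.single 0 1) {u : Fin 2 → 𝕜}
    (hu : u ∈ φ.source) (l r s : Fin 2) :
    (P.transform φ).b (φ u) l r s
      = μ u * !![0, 1; -1, 0] l r * if 1 = s then 1 else 0 := by
  have hpd : ∀ r k, pd k (pushforward φ v r) u = 0 := fun r k => by
    rw [pd_congr φ.open_source (fun u hu => pushforward_of_rectified (hrect u hu) r) hu, pd_const]
  have h0 := pushforward_of_rectified (hrect u hu) 0
  have h1 := pushforward_of_rectified (hrect u hu) 1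
  simp only [pushforward, Fin.sum_univ_two, Pi.single_eq_same, ne_eq, one_ne_zero,
    not_false_eq_true, Pi.single_eq_of_ne] at h0 h1
  -- Cramer's rule for `J v = (1, 0)`: the normal covector times `det J` is the differential of the
  -- second coordinate, which is why only `u²_x` appears in the result.
  have hn : ∀ k, normal (v u) k * (jac φ 0 0 u * jac φ 1 1 u - jac φ 0 1 u * jac φ 1 0 u)
      = jac φ 1 k u := by
    intro k
    fin_cases k
    · simp only [normal, Fin.zero_eta, Matrix.cons_val_zero]
      linear_combination jac φ 1 0 u * h0 - jac φ 0 0 u * h1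
    · simp only [normal, Fin.mk_one, Matrix.cons_val_one, Matrix.cons_val_fin_one]
      linear_combination jac φ 1 1 u * h0 - jac φ 0 1 u * h1
  have hminor : jac φ l 0 u * jac φ r 1 u - jac φ l 1 u * jac φ r 0 u
      = (jac φ 0 0 u * jac φ 1 1 u - jac φ 0 1 u * jac φ 1 0 u) * !![0, 1; -1, 0] l r := by
    fin_cases l <;> fin_cases r <;> simp <;> ring
  rw [h.transform_b hV hφ hu, ← hφ.sum_jac_mul_jac_symm hu, Finset.mul_sum]
  refine Finset.sum_congr rfl fun k _ => ?_
  rw [hpd, hminor, ← hn k]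
  ring

theorem HasRankOneForm.canBeBroughtTo_constForm (h : P.HasRankOneForm V v μ) (hV : IsOpen V)
    (hp : p ∈ V) (hμ : ∀ u ∈ V, μ u = 0) :
    P.CanBeBroughtTo V p (constForm 𝕜) Set.univ := by
  obtain ⟨φ, hφ, hrect⟩ := exists_flowBox hV h.contDiffOn_v hp (h.v_ne_zero p hp)
  refine ⟨φ, hφ, Set.subset_univ _, fun x hx => ⟨h.transform_g_of_rectified hφ hrect hx, ?_⟩⟩
  have hu := φ.map_target hx
  have hb := h.transform_b_of_rectified hV hφ hrect hu
  rw [φ.right_inv hx] at hb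
  funext l r s
  rw [hb, hμ _ (hφ.2.1 hu)]
  simp [constForm]

theorem HasRankOneForm.canBeBroughtTo_nonconstForm (h : P.HasRankOneForm V v μ) (hV : IsOpen V)
    (hp : p ∈ V) (hμ : ∀ u ∈ V, μ u ≠ 0) :
    P.CanBeBroughtTo V p (nonconstForm 𝕜) {x | x 0 ≠ 0} := by
  obtain ⟨φ, hφ, hrect⟩ := exists_flowBox hV h.contDiffOn_v hp (h.v_ne_zero p hp)
  -- By the Riccati equation `-1/μ` has derivative one along `v`, as the first rectifying coordinate
  -- does. Replacing that coordinate by it keeps `v` rectified and makes `μ` an explicit function of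
  -- the new variables.
  let y : (Fin 2 → 𝕜) → Fin 2 → 𝕜 := fun u => ![-(μ u)⁻¹, φ u 1]
  have hys : ContDiffOn 𝕜 ∞ y φ.source := by
    refine contDiffOn_pi.2 fun i => ?_
    fin_cases i
    · exact ((h.contDiffOn_μ.mono hφ.2.1).inv fun u hu => hμ u (hφ.2.1 hu)).neg
    · exact contDiffOn_pi.1 hφ.2.2.1 1
  have hyd : ∀ u ∈ φ.source, HasFDerivAt y (fderiv 𝕜 y u) u := fun u hu =>
    ((hys.contDiffAt (φ.open_source.mem_nhds hu)).differentiableAt (by simp)).hasFDerivAt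
  have hy0 : ∀ u ∈ φ.source, ∀ e, fderiv 𝕜 y u e 0 = (μ u ^ 2)⁻¹ * fderiv 𝕜 μ u e := by
    intro u hu e
    have hμd : HasFDerivAt μ (fderiv 𝕜 μ u) u :=
      ((h.contDiffOn_μ.contDiffAt (hV.mem_nhds (hφ.2.1 hu))).differentiableAt
        (by simp)).hasFDerivAt
    have h1 : HasFDerivAt (fun u => y u 0) _ u := (hasFDerivAt_pi'.1 (hyd u hu)) 0
    have h2 := ((hasDerivAt_inv (hμ u (hφ.2.1 hu))).comp_hasFDerivAt u hμd).neg
    have h3 := DFunLike.congr_fun (h1.unique h2) e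
    simpa using h3
  have hy1 : ∀ u ∈ φ.source, ∀ e, fderiv 𝕜 y u e 1 = fderiv 𝕜 φ u e 1 := by
    intro u hu e
    have h1 : HasFDerivAt (fun u => y u 1) _ u := (hasFDerivAt_pi'.1 (hyd u hu)) 1
    have h2 : HasFDerivAt (fun u => φ u 1) _ u :=
      (hasFDerivAt_pi'.1 (hφ.differentiableAt hu).hasFDerivAt) 1
    exact DFunLike.congr_fun (h1.unique h2) e
  have hyv : ∀ u ∈ φ.source, fderiv 𝕜 y u (v u) = Pi.single 0 1 := by
    intro u hu
    have hu' := hφ.2.1 hu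
    funext i
    fin_cases i
    · simp only [Fin.zero_eta, Pi.single_eq_same]
      rw [hy0 u hu, fderiv_eq_sum_pd, h.riccati u hu']
      exact inv_mul_cancel₀ (pow_ne_zero 2 (hμ u hu'))
    · simp only [Fin.mk_one]
      rw [hy1 u hu, hrect u hu]
  -- The kernel of the differential of the second coordinate is spanned by `v p`, on which the first
  -- coordinate has derivative one.
  have hinj : Function.Injective (fderiv 𝕜 y p) := by
    rw [injective_iff_map_eq_zero]
    intro e he
    have h1 : fderiv 𝕜 φ p e 1 = 0 := by rw [← hy1 p hφ.1, he, Pi.zero_apply]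
    have h2 : e = fderiv 𝕜 φ p e 0 • v p := by
      have h3 : fderiv 𝕜 φ p (e - fderiv 𝕜 φ p e 0 • v p) = 0 := by
        rw [map_sub, map_smul, hrect p hφ.1]
        funext i
        fin_cases i <;> simp [h1]
      have h4 : HasFDerivAt φ.symm (fderiv 𝕜 φ.symm (φ p)) (φ p) :=
        (hφ.differentiableAt_symm (φ.map_source hφ.1)).hasFDerivAt
      have h5 := h4.comp p (hφ.differentiableAt hφ.1).hasFDerivAt
      have h6 : HasFDerivAt (φ.symm ∘ φ) (ContinuousLinearMap.id 𝕜 (Fin 2 → 𝕜)) p :=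
        (hasFDerivAt_id _).congr_of_eventuallyEq (φ.eventually_left_inverse hφ.1)
      have h7 := DFunLike.congr_fun (h5.unique h6) (e - fderiv 𝕜 φ p e 0 • v p)
      rw [ContinuousLinearMap.comp_apply, h3, map_zero] at h7
      exact sub_eq_zero.1 h7.symm
    rw [h2, map_smul, hyv p hφ.1] at he
    have h8 := congrFun he 0
    simp only [Pi.smul_apply, Pi.single_eq_same, smul_eq_mul, mul_one, Pi.zero_apply] at h8
    rw [h2, h8, zero_smul]
  obtain ⟨ψ, hψp, hψs, hψc, hψi, hψy⟩ := exists_chart φ.open_source hys hφ.1 hinj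
  have hψ : IsChangeOfVariables V p ψ := ⟨hψp, hψs.trans hφ.2.1, hψc, hψi⟩
  have hψr : ∀ u ∈ ψ.source, fderiv 𝕜 ψ u (v u) = Pi.single 0 1 := fun u hu => by
    rw [hψy]
    exact hyv u (hψs hu)
  have hψ0 : ∀ x ∈ ψ.target, x 0 = -(μ (ψ.symm x))⁻¹ := fun x hx => by
    conv_lhs => rw [← ψ.right_inv hx, hψy]
    rfl
  refine ⟨ψ, hψ, fun x hx => ?_, fun x hx => ⟨h.transform_g_of_rectified hψ hψr hx, ?_⟩⟩
  · rw [Set.mem_ofPred_eq, hψ0 x hx]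
    exact neg_ne_zero.2 (inv_ne_zero (hμ _ (hψ.2.1 (ψ.map_target hx))))
  · have hu := ψ.map_target hx
    have hb := h.transform_b_of_rectified hV hψ hψr hu
    rw [ψ.right_inv hx] at hb
    funext l r s
    rw [hb]
    have h1 : 1 / x 0 = -μ (ψ.symm x) := by
      rw [hψ0 x hx, one_div, inv_neg, inv_inv]
    simp only [nonconstForm, h1]
    fin_cases l <;> fin_cases r <;> fin_cases s <;> simp

end DNOperator

/-! ### Regular points, the choice of sign, and the classification. -/

theorem matrix_eq_zero_of_rank_eq_zero {𝕜 : Type*} [Field 𝕜] {m n : ℕ}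
    {A : Matrix (Fin m) (Fin n) 𝕜} (h : A.rank = 0) : A = 0 := by
  rw [Matrix.rank, Submodule.finrank_eq_zero, LinearMap.range_eq_bot] at h
  ext i j
  have := congrFun (LinearMap.congr_fun h (Pi.single j 1)) i
  simpa using this

namespace DNOperator

variable {𝕜 : Type*} [RCLike 𝕜] {P : DNOperator 𝕜 2} {U V : Set (Fin 2 → 𝕜)} {p : Fin 2 → 𝕜}
  {v : (Fin 2 → 𝕜) → Fin 2 → 𝕜} {μ : (Fin 2 → 𝕜) → 𝕜}

theorem transform_neg_g (φ : OpenPartialHomeomorph (Fin 2 → 𝕜) (Fin 2 → 𝕜)) (x : Fin 2 → 𝕜) :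
    (P.neg.transform φ).g x = -(P.transform φ).g x := by
  ext l r
  simp [transform, neg]
  ring

theorem transform_neg_b (φ : OpenPartialHomeomorph (Fin 2 → 𝕜) (Fin 2 → 𝕜)) (x : Fin 2 → 𝕜) :
    (P.neg.transform φ).b x = -(P.transform φ).b x := by
  funext l r s
  simp [transform, neg]
  ring

theorem CanBeBroughtTo.of_neg {Q : DNOperator 𝕜 2} {Ω : Set (Fin 2 → 𝕜)}
    (h : P.neg.CanBeBroughtTo U p Q Ω) : P.CanBeBroughtTo U p Q.neg Ω := by
  obtain ⟨φ, hφ, hΩ, hQ⟩ := h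
  refine ⟨φ, hφ, hΩ, fun x hx => ?_⟩
  obtain ⟨h1, h2⟩ := hQ x hx
  rw [transform_neg_g] at h1
  rw [transform_neg_b] at h2
  exact ⟨neg_eq_iff_eq_neg.1 h1, neg_eq_iff_eq_neg.1 h2⟩

theorem CanBeBroughtTo.mono {Q : DNOperator 𝕜 2} {Ω : Set (Fin 2 → 𝕜)}
    (h : P.CanBeBroughtTo V p Q Ω) (hVU : V ⊆ U) : P.CanBeBroughtTo U p Q Ω := by
  obtain ⟨φ, hφ, hQ⟩ := h
  exact ⟨φ, hφ.mono hVU, hQ⟩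

theorem isRegularAt_neg_iff : P.neg.IsRegularAt U p ↔ P.IsRegularAt U p := by
  have hrank : ∀ u, (P.neg.g u).rank = (P.g u).rank := fun u => by
    have h := Matrix.rank_smul_of_mem_nonZeroDivisors (P.g u) (c := (-1 : 𝕜))
      (mem_nonZeroDivisors_of_ne_zero (neg_ne_zero.2 one_ne_zero))
    rwa [neg_one_smul] at h
  simp only [IsRegularAt, hrank, transform_neg_g, transform_neg_b, neg_inj, neg_eq_zero, ne_eq]

theorem HasRankOneForm.rank_eq_one (h : P.HasRankOneForm V v μ) {u : Fin 2 → 𝕜} (hu : u ∈ V) :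
    (P.g u).rank = 1 := by
  have hg : P.g u = Matrix.vecMulVec (v u) (v u) := by
    ext i j
    rw [h.g_eq u hu, Matrix.vecMulVec_apply]
  refine le_antisymm (hg ▸ Matrix.rank_vecMulVec_le _ _) ?_
  rw [Nat.one_le_iff_ne_zero]
  intro h0
  have h0 := matrix_eq_zero_of_rank_eq_zero h0
  refine h.v_ne_zero u hu (funext fun i => ?_)
  have h1 := h.g_eq u hu i i
  rw [h0, Matrix.zero_apply] at h1
  exact mul_self_eq_zero.1 h1.symm

/-- The zero set of `b` in constant-metric variables corresponds to that of `μ`, independently of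
the chart, so regularity can be tested on `μ` alone. -/
theorem HasRankOneForm.isRegularAt_iff (h : P.HasRankOneForm V v μ) (hV : IsOpen V) (hVU : V ⊆ U)
    (hp : p ∈ V) : P.IsRegularAt U p ↔ (∀ᶠ u in 𝓝 p, μ u = 0) ∨ μ p ≠ 0 := by
  have hiff : ∀ φ : OpenPartialHomeomorph (Fin 2 → 𝕜) (Fin 2 → 𝕜), IsChangeOfVariables V p φ →
      (∀ x ∈ φ.target, (P.transform φ).g x = (P.transform φ).g (φ p)) →
      (((∀ᶠ x in 𝓝 (φ p), (P.transform φ).b x = 0) ∨ (P.transform φ).b (φ p) ≠ 0) ↔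
        (∀ᶠ u in 𝓝 p, μ u = 0) ∨ μ p ≠ 0) := by
    intro φ hφ hg
    refine or_congr ⟨fun hb => ?_, fun hμ => ?_⟩
      (not_congr (h.transform_b_eq_zero_iff hV hφ hg hφ.1))
    · filter_upwards [(φ.continuousAt hφ.1).eventually hb, φ.open_source.mem_nhds hφ.1]
        with u hu hus
      exact (h.transform_b_eq_zero_iff hV hφ hg hus).1 hu
    · have ht : Filter.Tendsto φ.symm (𝓝 (φ p)) (𝓝 p) := φ.tendsto_symm hφ.1
      filter_upwards [ht.eventually hμ, φ.open_target.mem_nhds (φ.map_source hφ.1)] with x hx hxt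
      rw [← φ.right_inv hxt]
      exact (h.transform_b_eq_zero_iff hV hφ hg (φ.map_target hxt)).2 hx
  constructor
  · intro hreg
    -- The regularity condition quantifies over constant-metric charts; a flow box supplies one, so
    -- the condition is not vacuous.
    obtain ⟨φ, hφ, hrect⟩ := exists_flowBox hV h.contDiffOn_v hp (h.v_ne_zero p hp)
    have hg : ∀ x ∈ φ.target, (P.transform φ).g x = (P.transform φ).g (φ p) := fun x hx => by
      rw [h.transform_g_of_rectified hφ hrect hx,
        h.transform_g_of_rectified hφ hrect (φ.map_source hφ.1)]
    exact (hiff φ hφ hg).1 (hreg.2 φ (hφ.mono hVU) hg)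
  · intro hμ
    refine ⟨?_, fun φ hφ hg => ?_⟩
    · filter_upwards [hV.mem_nhds hp] with u hu
      rw [h.rank_eq_one hu, h.rank_eq_one hp]
    · exact (hiff (φ.restrOpen V hV) (hφ.restrOpen hV hp) fun x hx => hg x hx.1).2 hμ

theorem HasRankOneForm.canBeBroughtTo (h : P.HasRankOneForm V v μ) (hV : IsOpen V) (hp : p ∈ V)
    (hμ : (∀ᶠ u in 𝓝 p, μ u = 0) ∨ μ p ≠ 0) :
    P.CanBeBroughtTo V p (constForm 𝕜) Set.univ ∨
      P.CanBeBroughtTo V p (nonconstForm 𝕜) {x | x 0 ≠ 0} := by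
  rcases hμ with hμ | hμ
  · obtain ⟨W, hW, hWo, hpW⟩ := eventually_nhds_iff.1 hμ
    have h' := h.mono (W := V ∩ W) Set.inter_subset_left
    exact Or.inl ((h'.canBeBroughtTo_constForm (hV.inter hWo) ⟨hp, hpW⟩
      fun u hu => hW u hu.2).mono Set.inter_subset_left)
  · have hWo : IsOpen (V ∩ μ ⁻¹' {0}ᶜ) :=
      h.contDiffOn_μ.continuousOn.isOpen_inter_preimage hV isOpen_compl_singleton
    have h' := h.mono (W := V ∩ μ ⁻¹' {0}ᶜ) Set.inter_subset_left
    exact Or.inr ((h'.canBeBroughtTo_nonconstForm hWo ⟨hp, hμ⟩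
      fun u hu => hu.2).mono Set.inter_subset_left)

/-- Take `v^i = g^{im} / √g^{mm}`; vanishing of the determinant is what makes `v ⊗ v` agree with `g`
in the remaining entry. -/
theorem IsPoissonOn.exists_hasRankOneForm_of_sq (hV : IsOpen V) (hP : P.IsPoissonOn V)
    (hdet : P.IsDegenerate V) {m : Fin 2} {r : (Fin 2 → 𝕜) → 𝕜} (hr : ContDiffOn 𝕜 ∞ r V)
    (hr0 : ∀ u ∈ V, r u ≠ 0 ∧ r u ^ 2 = P.g u m m) : ∃ v μ, P.HasRankOneForm V v μ := by
  refine ⟨fun u i => P.g u i m / r u, hP.exists_hasRankOneForm hV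
    (contDiffOn_pi.2 fun i => (hP.smooth.1 i m).div hr fun u hu => (hr0 u hu).1)
    (fun u hu i j => ?_) (m := m) fun u hu => ?_⟩
  · obtain ⟨h0, h2⟩ := hr0 u hu
    have hd := hdet u hu
    have hs := hP.g_symm u hu 1 0
    rw [Matrix.det_fin_two] at hd
    rw [div_mul_div_comm, ← sq, h2, eq_div_iff (h2 ▸ pow_ne_zero 2 h0)]
    rw [hs] at hd
    fin_cases m <;> fin_cases i <;> fin_cases j <;> simp [hs] <;>
      first | ring1 | linear_combination hd
  · obtain ⟨h0, h2⟩ := hr0 u hu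
    rw [← h2]
    exact div_ne_zero (pow_ne_zero 2 h0) h0

theorem IsPoissonOn.exists_hasRankOneForm_or_neg (hU : IsOpen U) (hP : P.IsPoissonOn U)
    (hdet : P.IsDegenerate U) (hp : p ∈ U) (hg : P.g p ≠ 0) :
    ∃ V, IsOpen V ∧ p ∈ V ∧ V ⊆ U ∧ ∃ v μ, P.HasRankOneForm V v μ ∨
      ((RCLike.I : 𝕜) = 0 ∧ P.neg.HasRankOneForm V v μ) := by
  -- With zero diagonal the determinant of a symmetric matrix is minus the square of its
  -- off-diagonal entry, so degeneracy would give `g = 0`.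
  obtain ⟨m, hm⟩ : ∃ m, P.g p m m ≠ 0 := by
    by_contra! h
    have hd := hdet p hp
    have hs := hP.g_symm p hp 1 0
    rw [Matrix.det_fin_two, h 0, h 1, hs, zero_mul, zero_sub, neg_eq_zero,
      mul_self_eq_zero] at hd
    refine hg ?_
    ext i j
    fin_cases i <;> fin_cases j <;> simp [h, hd, hs]
  obtain ⟨ε, hε, V, hV, hpV, hVU, r, hr, hr0⟩ :=
    exists_local_sqrt hU (hP.smooth.1 m m) hp hm
  refine ⟨V, hV, hpV, hVU, ?_⟩
  rcases hε with rfl | ⟨rfl, hI⟩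
  · obtain ⟨v, μ, h⟩ := (hP.mono hVU).exists_hasRankOneForm_of_sq hV
      (fun u hu => hdet u (hVU hu)) hr (by simpa using hr0)
    exact ⟨v, μ, Or.inl h⟩
  · obtain ⟨v, μ, h⟩ := (hP.mono hVU).neg.exists_hasRankOneForm_of_sq hV
      (fun u hu => by
        have h : (-P.g u).det = 0 := by rw [Matrix.det_neg, hdet u (hVU hu), mul_zero]
        exact h) (m := m) hr (fun u hu => ⟨(hr0 u hu).1, (hr0 u hu).2.trans (neg_one_mul _)⟩)
    exact ⟨v, μ, Or.inr ⟨hI, h⟩⟩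

theorem IsPoissonOn.isRegularAt_of_g_eq_zero (hV : IsOpen V) (hP : P.IsPoissonOn V)
    (hp : p ∈ V) (hg : ∀ u ∈ V, P.g u = 0) : P.IsRegularAt U p := by
  refine ⟨?_, fun φ hφ _ => Or.inl ?_⟩
  · filter_upwards [hV.mem_nhds hp] with u hu
    rw [hg u hu, hg p hp]
  · have ht : Filter.Tendsto φ.symm (𝓝 (φ p)) (𝓝 p) := φ.tendsto_symm hφ.1
    filter_upwards [ht.eventually (hV.mem_nhds hp)] with x hx
    funext l r s
    simp [transform, hg _ hx, hP.b_eq_zero hV hg hx]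

end DNOperator

/-- `𝕜` is `ℝ` or `ℂ`; the condition `RCLike.I = 0` says that `𝕜` is `ℝ`, and only then an
overall sign may be needed. -/
theorem theorem2 {𝕜 : Type*} [RCLike 𝕜] (U : Set (Fin 2 → 𝕜)) (hU : IsOpen U)
    (P : DNOperator 𝕜 2) (hsmooth : P.SmoothOn U) (hham : P.IsHamiltonian U)
    (hdeg : P.IsDegenerate U) :
    U ⊆ closure {p | p ∈ U ∧ P.IsRegularAt U p} ∧
    ∀ p ∈ U, P.IsRegularAt U p → ¬ P.IsTrivialNear p →
      (P.CanBeBroughtTo U p (DNOperator.constForm 𝕜) Set.univ ∨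
        P.CanBeBroughtTo U p (DNOperator.nonconstForm 𝕜) {v | v 0 ≠ 0}) ∨
      ((RCLike.I : 𝕜) = 0 ∧
        (P.CanBeBroughtTo U p (DNOperator.constForm 𝕜).neg Set.univ ∨
          P.CanBeBroughtTo U p (DNOperator.nonconstForm 𝕜).neg {v | v 0 ≠ 0})) := by
  have hP := hham.isPoissonOn hU hsmooth
  refine ⟨fun p₀ hp₀ => mem_closure_iff.2 fun W hW hpW => ?_, fun p hp hreg htriv => ?_⟩
  · by_cases hg : ∀ u ∈ U ∩ W, P.g u = 0
    · exact ⟨p₀, hpW, hp₀, (hP.mono Set.inter_subset_left).isRegularAt_of_g_eq_zero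
        (hU.inter hW) ⟨hp₀, hpW⟩ hg⟩
    · push Not at hg
      obtain ⟨p, hp, hgp⟩ := hg
      obtain ⟨V, hV, hpV, hVU, v, μ, hform⟩ := (hP.mono Set.inter_subset_left)
        |>.exists_hasRankOneForm_or_neg (hU.inter hW) (fun u hu => hdeg u hu.1) hp hgp
      -- Either `μ` vanishes throughout `V` or some point of `V` has `μ ≠ 0`; in both cases there is
      -- a regular point inside the given neighbourhood.
      obtain ⟨q, hq, hμ⟩ : ∃ q ∈ V, (∀ᶠ u in 𝓝 q, μ u = 0) ∨ μ q ≠ 0 := by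
        by_cases h0 : ∀ u ∈ V, μ u = 0
        · exact ⟨p, hpV, Or.inl (Filter.eventually_of_mem (hV.mem_nhds hpV) h0)⟩
        · push Not at h0
          obtain ⟨q, hq, hμ⟩ := h0
          exact ⟨q, hq, Or.inr hμ⟩
      refine ⟨q, (hVU hq).2, (hVU hq).1, ?_⟩
      have hVU' : V ⊆ U := hVU.trans Set.inter_subset_left
      rcases hform with h | ⟨-, h⟩
      · exact (h.isRegularAt_iff hV hVU' hq).2 hμ
      · exact DNOperator.isRegularAt_neg_iff.1 ((h.isRegularAt_iff hV hVU' hq).2 hμ)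
  · by_cases hg : P.g p = 0
    · refine absurd ?_ htriv
      -- Constant rank spreads `g = 0` from `p` to a neighbourhood, where `b` then vanishes too,
      -- against nontriviality.
      obtain ⟨W, hW, hWo, hpW⟩ := eventually_nhds_iff.1 hreg.1
      have hg0 : ∀ u ∈ U ∩ W, P.g u = 0 := fun u hu => by
        exact matrix_eq_zero_of_rank_eq_zero (by rw [hW u hu.2, hg, Matrix.rank_zero])
      exact Filter.eventually_of_mem ((hU.inter hWo).mem_nhds ⟨hp, hpW⟩) fun u hu =>
        ⟨hg0 u hu, (hP.mono Set.inter_subset_left).b_eq_zero (hU.inter hWo) hg0 hu⟩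
    · obtain ⟨V, hV, hpV, hVU, v, μ, h | ⟨hI, h⟩⟩ :=
        hP.exists_hasRankOneForm_or_neg hU hdeg hp hg
      · exact Or.inl ((h.canBeBroughtTo hV hpV ((h.isRegularAt_iff hV hVU hpV).1 hreg)).imp
          (·.mono hVU) (·.mono hVU))
      · exact Or.inr ⟨hI, (h.canBeBroughtTo hV hpV ((h.isRegularAt_iff hV hVU hpV).1
          (DNOperator.isRegularAt_neg_iff.2 hreg))).imp
          (·.mono hVU |>.of_neg) (·.mono hVU |>.of_neg)⟩
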